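/- \textbf{Theorem (two-variable Fej\'er--Riesz).} Let $n,m\ge 0$ be integers and suppose that $f(z,w)=\sum_{k=-n}^{n}\sum_{l=-m}^{m}f_{kl}z^kw^l$ (with $f_{kl}\in\mathbb C$) is real and strictly positive for $|z|=|w|=1$. Let $$\mathcal L(g)=\frac1{(2\pi)^2}\int_{-\pi}^{\pi}\int_{-\pi}^{\pi}\frac{g(e^{i\theta},e^{i\varphi})}{f(e^{i\theta},e^{i\varphi})}\,d\theta\,d\varphi ,\qquad \langle P,Q\rangle=\mathcal L(P\,\overline{Q}).$$ For $0\le l\le M$, let $\phi^{l}_{N,M}$ be the polynomial obtained at the monomial $z^Nw^l$ when the Gram--Schmidt procedure with respect to $\langle\cdot,\cdot\rangle$ is applied to the monomials $z^iw^j$, $0\le i\le N$, $0\le j\le M$, in the lexicographical ordering ($(i,j)<(i',j')$ iff $i<i'$, or $i=i'$ and $j<j'$), normalized to have norm $1$ and a positive coefficient at $z^Nw^l$. For $0\le l\le N$, let $\tilde\phi^{l}_{N,M}$ be the polynomial obtained in the same way at the monomial $z^lw^M$ when the reverse lexicographical ordering ($(i,j)<(i',j')$ iff $j<j'$, or $j=j'$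 and $i<i'$) is used. Let $\mathcal K_{n,m}$ be the $m\times n$ matrix $$\mathcal K_{n,m}=\Big(\big\langle \phi^{\,m-1-i}_{n,m-1},\ \tilde\phi^{\,n-1-j}_{n-1,m}\big\rangle\Big)_{0\le i\le m-1,\ 0\le j\le n-1}$$ (the empty matrix, regarded as zero, if $n=0$ or $m=0$). Then there exists a polynomial $p(z,w)=\sum_{k=0}^{n}\sum_{l=0}^{m}p_{kl}z^kw^l$ with $p(z,w)\neq0$ for all $|z|\le1$, $|w|\le 1$ and $f(z,w)=|p(z,w)|^2$ for $|z|=|w|=1$, if and only if $\mathcal K_{n,m}=0$. -/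

import Mathlib

namespace Bicircle

/-- The Laurent polynomial `f(z,w) = ∑_{k=-n}^{n} ∑_{l=-m}^{m} c_{k,l} z^k w^l`. -/
noncomputable def laurent (n m : ℕ) (c : ℤ → ℤ → ℂ) (z w : ℂ) : ℂ :=
  ∑ k ∈ Finset.Icc (-(n : ℤ)) n, ∑ l ∈ Finset.Icc (-(m : ℤ)) m, c k l * z ^ k * w ^ l

/-- The value `p(z,w)` of a polynomial in two variables (variable `0` is `z`, variable `1` is `w`). -/
noncomputable def val (p : MvPolynomial (Fin 2) ℂ) (z w : ℂ) : ℂ :=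
  MvPolynomial.eval ![z, w] p

/-- The functional with density `1/f` on the bicircle,
`L(g) = (2π)⁻² ∫∫ g(e^{iθ}, e^{iφ}) / f(e^{iθ}, e^{iφ}) dθ dφ`. -/
noncomputable def functional (f : ℂ → ℂ → ℂ) (g : ℂ → ℂ → ℂ) : ℂ :=
  (1 / (2 * (Real.pi : ℂ)) ^ 2) *
    ∫ θ in (-Real.pi)..Real.pi, ∫ φ in (-Real.pi)..Real.pi,
      g (Complex.exp (θ * Complex.I)) (Complex.exp (φ * Complex.I)) /
        f (Complex.exp (θ * Complex.I)) (Complex.exp (φ * Complex.I))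

/-- The form `⟨P, Q⟩ = L(P Q†)`; on the bicircle `Q†` is the complex conjugate of `Q`. -/
noncomputable def form (L : (ℂ → ℂ → ℂ) → ℂ) (P Q : MvPolynomial (Fin 2) ℂ) : ℂ :=
  L (fun z w => val P z w * (starRingEnd ℂ) (val Q z w))

/-- The Gram–Schmidt procedure, with normalization, for a form `B` that is linear in its first
and conjugate linear in its second argument. It is applied to the vectors `e i`, `i ∈ S`, in the
order of the index type: `gramSchmidt B e S k` is the residual of `e k` after projection onto the
vectors already obtained from the indices `i < k` in `S`, divided by its norm. -/
noncomputable def gramSchmidt {ι V : Type*} [LinearOrder ι] [WellFoundedLT ι]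
    [AddCommGroup V] [Module ℂ V] (B : V → V → ℂ) (e : ι → V) (S : Finset ι) (k : ι) : V :=
  let r : V := e k - ∑ i ∈ (S.filter (· < k)).attach,
    B (e k) (gramSchmidt B e S i.1) • gramSchmidt B e S i.1
  ((Real.sqrt (B r r).re : ℂ))⁻¹ • r
termination_by (wellFounded_lt (α := ι)).wrap k
decreasing_by all_goals exact (Finset.mem_filter.1 i.2).2

/-- The orthonormal polynomial `φ^l_{n,m}` (for `l ≤ m`): Gram–Schmidt for the monomials
`z^i w^j`, `0 ≤ i ≤ n`, `0 ≤ j ≤ m`, in the lexicographical ordering of the pairs `(i,j)`,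
evaluated at `(n,l)`. -/
noncomputable def lexPoly (L : (ℂ → ℂ → ℂ) → ℂ) (n m l : ℕ) : MvPolynomial (Fin 2) ℂ :=
  gramSchmidt (form L)
    (fun x : ℕ ×ₗ ℕ =>
      (MvPolynomial.X 0 ^ (ofLex x).1 * MvPolynomial.X 1 ^ (ofLex x).2 : MvPolynomial (Fin 2) ℂ))
    ((Finset.range (n + 1) ×ˢ Finset.range (m + 1)).map toLex.toEmbedding)
    (toLex (n, l))

/-- The orthonormal polynomial `φ̃^l_{n,m}` (for `l ≤ n`) of the reverse lexicographical ordering: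
Gram–Schmidt for the monomials `z^i w^j`, `0 ≤ i ≤ n`, `0 ≤ j ≤ m`, in the lexicographical
ordering of the pairs `(j,i)`, evaluated at `(m,l)`. -/
noncomputable def revlexPoly (L : (ℂ → ℂ → ℂ) → ℂ) (n m l : ℕ) : MvPolynomial (Fin 2) ℂ :=
  gramSchmidt (form L)
    (fun x : ℕ ×ₗ ℕ =>
      (MvPolynomial.X 0 ^ (ofLex x).2 * MvPolynomial.X 1 ^ (ofLex x).1 : MvPolynomial (Fin 2) ℂ))
    ((Finset.range (m + 1) ×ˢ Finset.range (n + 1)).map toLex.toEmbedding)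
    (toLex (m, l))

/-- The `m × n` matrix `𝒦_{n,m} = ⟨Φ_{n,m-1}, Φ̃_{n-1,m}⟩`, where
`Φ_{n,m-1} = (φ^{m-1}_{n,m-1}, …, φ^0_{n,m-1})ᵀ` and
`Φ̃_{n-1,m} = (φ̃^{n-1}_{n-1,m}, …, φ̃^0_{n-1,m})ᵀ`.
For `n = 0` or `m = 0` it is the empty matrix; otherwise no subtraction below truncates. -/
noncomputable def KMatrix (L : (ℂ → ℂ → ℂ) → ℂ) (n m : ℕ) : Matrix (Fin m) (Fin n) ℂ :=
  Matrix.of fun i j =>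
    form L (lexPoly L n (m - 1) (m - 1 - i)) (revlexPoly L (n - 1) m (n - 1 - j))

end Bicircle

/-! ### Laurent polynomials, reflections and Toeplitz forms. -/

namespace Bicircle

open Finset
open scoped ComplexConjugate

/-! Write `box a b` for the polynomials of degree `< a` in `z` and `< b` in `w`, with the form whose
moments are the Fourier coefficients of `1/f`. The form is Toeplitz: multiplication by a monomial
preserves it, and reflection of polynomials reverses it. The Gram–Schmidt polynomials in the matrix
are orthonormal bases of `box (n+1) m ⊖ box n m` and `box n (m+1) ⊖ box n m`, so the vanishing of
the matrix is the basis-free statement `SplitOrth` that these two spaces are orthogonal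
(`KMatrix_eq_zero_iff`).

Necessity (`Stable.splitOrth`). If `f = |p|²` with `p` stable, division by `p` carries the form to
the inner product of `L²` of the torus, and `1/p` has only nonnegative frequencies. Tracking which
frequencies can survive multiplication by `p`, `1/p` and their conjugates shows that a polynomial in
`box (n+1) m` orthogonal to `box n m` is orthogonal to all `z^i w^j` with `i < n`, `j ≥ 0`
(`inner_eq_zero_of_box`).

Sufficiency. Let `p` be the unit vector of bidegree `(n, m)` orthogonal to every nonconstant
monomial, and `q` its reflection. Under `SplitOrth`, comparing reproducing kernels of boxes with
their reflections gives a Christoffel–Darboux formula expressing `p p̄ - q q̄` as `(1 - w w̄') Σ ε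
ε̄ + (1 - z z̄') Σ ψ ψ̄` (`christoffel_darboux`). The `ψ k` are an orthonormal basis of `box n (m+1)
⊖ w · box n m`, and the matrix of their `z`-coefficients is invertible for `|w| ≤ 1`
(`det_matPoly_ne_zero`); hence they have no common zero there and `p` is stable (`ev_ne_zero`).

It remains to see that `f = |p|²`. On each fibre `|w| = 1` the formula identifies `Σ ψ ψ̄` as the
reproducing kernel for the weight `1/|p|²`; the mean value property in `w` then shows that `1/f` and
`1/|p|²` give the same products with the `ψ k`, which determines the form on `box n (m+1)`
(`pair_eq_pair`). Symmetry and separate arguments at the corners give agreement of all moments in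
`[-n, n] × [-m, m]` (`moment_eq`). Since `f` and `|p|²` have frequencies in that rectangle, the
integral of `(f - |p|²)² / (f |p|²)` vanishes (`ev_eq_of_moment_eq`). -/

/-- Laurent polynomials in two variables, as finitely supported families of coefficients. -/
abbrev Trig := ℤ × ℤ →₀ ℂ

/-- Multiplication by the monomial `z ^ s.1 * w ^ s.2`. -/
noncomputable def shift (s : ℤ × ℤ) : Trig →ₗ[ℂ] Trig :=
  (Finsupp.domLCongr (Equiv.addRight s)).toLinearMap

@[simp] lemma shift_apply (s t : ℤ × ℤ) (x : Trig) : shift s x t = x (t - s) := by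
  simp [shift, Finsupp.domLCongr_apply, sub_eq_add_neg]

@[simp] lemma shift_single (s t : ℤ × ℤ) (a : ℂ) :
    shift s (Finsupp.single t a) = Finsupp.single (t + s) a := by
  simp [shift]

/-- The reflection `x ↦ z ^ s.1 * w ^ s.2 * conj x`. -/
noncomputable def refl (s : ℤ × ℤ) (x : Trig) : Trig :=
  (Finsupp.equivMapDomain (Equiv.subLeft s) x).mapRange conj (map_zero _)

@[simp] lemma refl_apply (s t : ℤ × ℤ) (x : Trig) : refl s x t = conj (x (s - t)) := by
  simp [refl, Finsupp.equivMapDomain_apply, neg_add_eq_sub]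

@[simp] lemma refl_refl (s : ℤ × ℤ) (x : Trig) : refl s (refl s x) = x := by
  ext t; simp

lemma refl_add (s : ℤ × ℤ) (x y : Trig) : refl s (x + y) = refl s x + refl s y := by
  ext t; simp

@[simp] lemma refl_single (s t : ℤ × ℤ) (a : ℂ) :
    refl s (Finsupp.single t a) = Finsupp.single (s - t) (conj a) := by
  classical
  ext u
  simp only [refl_apply, Finsupp.single_apply]
  have : t = s - u ↔ s - t = u := by
    constructor <;> rintro rfl <;> abel
  by_cases h : t = s - u
  · rw [if_pos h, if_pos (this.1 h)]
  · rw [if_neg h, if_neg (fun h' => h (this.2 h')), map_zero]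

lemma shift_refl (s t : ℤ × ℤ) (x : Trig) : shift s (refl t x) = refl (s + t) x := by
  ext u; simp only [shift_apply, refl_apply]; congr 2; abel

/-- The exponents `(i, j)` with `0 ≤ i < a` and `0 ≤ j < b`. -/
def boxSet (a b : ℕ) : Set (ℤ × ℤ) := Set.Ico 0 (a : ℤ) ×ˢ Set.Ico 0 (b : ℤ)

lemma mem_boxSet {a b : ℕ} {s : ℤ × ℤ} :
    s ∈ boxSet a b ↔ (0 ≤ s.1 ∧ s.1 < a) ∧ (0 ≤ s.2 ∧ s.2 < b) := by
  simp [boxSet]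

/-- The polynomials of degree `< a` in the first and `< b` in the second variable. -/
noncomputable def box (a b : ℕ) : Submodule ℂ Trig := Finsupp.supported ℂ ℂ (boxSet a b)

lemma mem_box {a b : ℕ} {x : Trig} : x ∈ box a b ↔ ∀ s, s ∉ boxSet a b → x s = 0 := by
  rw [box, Finsupp.mem_supported']

lemma single_mem_box {a b : ℕ} {s : ℤ × ℤ} (h : s ∈ boxSet a b) (c : ℂ) :
    Finsupp.single s c ∈ box a b := Finsupp.single_mem_supported ℂ c h

lemma box_mono {a b a' b' : ℕ} (ha : a ≤ a') (hb : b ≤ b') : box a b ≤ box a' b' := by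
  apply Finsupp.supported_mono
  intro s
  simp only [mem_boxSet]
  omega

lemma boxSet_finite (a b : ℕ) : (boxSet a b).Finite :=
  (Set.finite_Ico _ _).prod (Set.finite_Ico _ _)

instance (a b : ℕ) : Finite (boxSet a b) := (boxSet_finite a b)

instance (a b : ℕ) : Module.Finite ℂ (box a b) :=
  Module.Finite.equiv (Finsupp.supportedEquivFinsupp (M := ℂ) (R := ℂ) (boxSet a b)).symm

lemma finrank_box (a b : ℕ) : Module.finrank ℂ (box a b) = a * b := by
  classical
  rw [box, (Finsupp.supportedEquivFinsupp (M := ℂ) (R := ℂ) (boxSet a b)).finrank_eq]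
  have := Fintype.ofFinite (boxSet a b)
  rw [Module.finrank_finsupp_self, ← Nat.card_eq_fintype_card, boxSet]
  rw [Nat.card_congr (Equiv.Set.prod _ _), Nat.card_prod]
  simp

lemma box_induction {a b : ℕ} {P : Trig → Prop} (h0 : P 0) (hadd : ∀ x y, P x → P y → P (x + y))
    (hs : ∀ s ∈ boxSet a b, ∀ c, P (Finsupp.single s c)) {x : Trig} (hx : x ∈ box a b) : P x := by
  rw [← x.sum_single]
  have : ∀ s ∈ x.support, P (Finsupp.single s (x s)) := fun s h => by
    apply hs
    by_contra h'
    exact (Finsupp.mem_support_iff.1 h) (mem_box.1 hx s h')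
  rw [Finsupp.sum]
  exact Finset.sum_induction _ P hadd h0 this

lemma shift_mem_box {a b a' b' : ℕ} {s : ℤ × ℤ} {x : Trig} (hx : x ∈ box a b)
    (h1 : 0 ≤ s.1) (h2 : a + s.1 ≤ a') (h3 : 0 ≤ s.2) (h4 : b + s.2 ≤ b') :
    shift s x ∈ box a' b' := by
  rw [mem_box] at *
  intro t ht
  rw [shift_apply]
  apply hx
  contrapose! ht
  simp only [mem_boxSet, Prod.fst_sub, Prod.snd_sub] at *
  omega

lemma refl_mem_box {a b a' b' : ℕ} {s : ℤ × ℤ} {x : Trig} (hx : x ∈ box a b)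
    (h1 : s.1 < a') (h2 : a ≤ s.1 + 1) (h3 : s.2 < b') (h4 : b ≤ s.2 + 1) :
    refl s x ∈ box a' b' := by
  rw [mem_box] at *
  intro t ht
  rw [refl_apply, hx, map_zero]
  contrapose! ht
  simp only [mem_boxSet, Prod.fst_sub, Prod.snd_sub] at *
  omega

/-- Evaluation at a point. -/
noncomputable def ev (z w : ℂ) : Trig →ₗ[ℂ] ℂ :=
  Finsupp.linearCombination ℂ (fun s : ℤ × ℤ => z ^ s.1 * w ^ s.2)

lemma ev_single (z w : ℂ) (s : ℤ × ℤ) (a : ℂ) :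
    ev z w (Finsupp.single s a) = a * (z ^ s.1 * w ^ s.2) := by
  simp [ev]

/-- Membership in a box makes all exponents nonnegative; with negative ones the identity would fail
at `z = 0` or `w = 0`, where `0⁻¹ = 0`. -/
lemma ev_shift {a b : ℕ} {x : Trig} (hx : x ∈ box a b) (z w : ℂ) (i j : ℕ) :
    ev z w (shift (i, j) x) = z ^ i * w ^ j * ev z w x := by
  refine box_induction (P := fun x => ev z w (shift (i, j) x) = z ^ i * w ^ j * ev z w x)
    (by simp) ?_ ?_ hx
  · intro x y hx hy
    simp only [map_add, hx, hy]; ring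
  · intro s hs c
    obtain ⟨⟨h1, -⟩, h2, -⟩ := mem_boxSet.1 hs
    obtain ⟨k, hk⟩ := Int.eq_ofNat_of_zero_le h1
    obtain ⟨l, hl⟩ := Int.eq_ofNat_of_zero_le h2
    have e1 : (k : ℤ) + i = ((k + i : ℕ) : ℤ) := by push_cast; ring
    have e2 : (l : ℤ) + j = ((l + j : ℕ) : ℤ) := by push_cast; ring
    simp only [shift_single, ev_single, Prod.fst_add, Prod.snd_add, hk, hl, e1, e2, zpow_natCast]
    ring

lemma ev_refl {z w : ℂ} (hz : ‖z‖ = 1) (hw : ‖w‖ = 1) (s : ℤ × ℤ) (x : Trig) :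
    ev z w (refl s x) = z ^ s.1 * w ^ s.2 * conj (ev z w x) := by
  have hz0 : z ≠ 0 := by rintro rfl; simp at hz
  have hw0 : w ≠ 0 := by rintro rfl; simp at hw
  have cz : conj z = z⁻¹ := (Complex.inv_eq_conj hz).symm
  have cw : conj w = w⁻¹ := (Complex.inv_eq_conj hw).symm
  induction x using Finsupp.induction_linear with
  | zero =>
    have : refl s 0 = 0 := by ext; simp
    simp [this]
  | add x y hx hy => rw [refl_add, map_add, hx, hy, map_add, map_add]; ring
  | single t a =>
    simp only [refl_single, ev_single, map_mul, map_zpow₀, cz, cw, Prod.fst_sub, Prod.snd_sub,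
      zpow_sub₀ hz0, zpow_sub₀ hw0, inv_zpow]
    ring

/-- The Hermitian form on Laurent polynomials with moments `c`. -/
noncomputable def pair (c : ℤ × ℤ → ℂ) (x y : Trig) : ℂ :=
  x.sum fun s a => y.sum fun t b => a * conj b * c (s - t)

section pair
variable (c : ℤ × ℤ → ℂ)

@[simp] lemma pair_zero_left (y : Trig) : pair c 0 y = 0 := by simp [pair]

@[simp] lemma pair_zero_right (x : Trig) : pair c x 0 = 0 := by simp [pair]

lemma pair_add_left (x x' y : Trig) : pair c (x + x') y = pair c x y + pair c x' y := by
  rw [pair, Finsupp.sum_add_index' (by simp)]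
  · rfl
  · intro s a b
    rw [← Finsupp.sum_add]
    congr 1; ext t u; ring

lemma pair_add_right (x y y' : Trig) : pair c x (y + y') = pair c x y + pair c x y' := by
  simp only [pair, ← Finsupp.sum_add]
  congr 1; ext s a
  rw [Finsupp.sum_add_index' (by simp)]
  intro t u v
  simp only [map_add]; ring

lemma pair_single (s t : ℤ × ℤ) (a b : ℂ) :
    pair c (Finsupp.single s a) (Finsupp.single t b) = a * conj b * c (s - t) := by
  simp [pair]

lemma pair_smul_left (r : ℂ) (x y : Trig) : pair c (r • x) y = r * pair c x y := by
  rw [pair, Finsupp.sum_smul_index' (by simp), pair, Finsupp.mul_sum]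
  congr 1; ext s a
  rw [Finsupp.mul_sum]
  congr 1; ext t b
  simp only [smul_eq_mul]; ring

lemma pair_smul_right (r : ℂ) (x y : Trig) : pair c x (r • y) = conj r * pair c x y := by
  rw [pair, pair, Finsupp.mul_sum]
  congr 1; ext s a
  rw [Finsupp.sum_smul_index' (by simp), Finsupp.mul_sum]
  congr 1; ext t b
  simp only [smul_eq_mul, map_mul]; ring

/-- `pair` as a linear map in the first argument. -/
noncomputable def pairL (y : Trig) : Trig →ₗ[ℂ] ℂ where
  toFun x := pair c x y
  map_add' x x' := pair_add_left c x x' y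
  map_smul' r x := pair_smul_left c r x y

/-- `pair` as a conjugate linear map in the second argument. -/
noncomputable def pairR (x : Trig) : Trig →ₛₗ[starRingEnd ℂ] ℂ where
  toFun y := pair c x y
  map_add' y y' := pair_add_right c x y y'
  map_smul' r y := pair_smul_right c r x y

lemma pair_sub_left (x x' y : Trig) : pair c (x - x') y = pair c x y - pair c x' y :=
  (pairL c y).map_sub x x'

lemma pair_sub_right (x y y' : Trig) : pair c x (y - y') = pair c x y - pair c x y' :=
  (pairR c x).map_sub y y'

lemma pair_sum_left {ι : Type*} (S : Finset ι) (v : ι → Trig) (y : Trig) :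
    pair c (∑ i ∈ S, v i) y = ∑ i ∈ S, pair c (v i) y := map_sum (pairL c y) v S

lemma pair_sum_right {ι : Type*} (S : Finset ι) (v : ι → Trig) (x : Trig) :
    pair c x (∑ i ∈ S, v i) = ∑ i ∈ S, pair c x (v i) := map_sum (pairR c x) v S

/-- The Toeplitz property: moments enter only through differences of exponents. -/
lemma pair_shift (s : ℤ × ℤ) (x y : Trig) : pair c (shift s x) (shift s y) = pair c x y := by
  induction x using Finsupp.induction_linear with
  | zero => simp
  | add x x' hx hx' => simp only [map_add, pair_add_left, hx, hx']
  | single t a =>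
    induction y using Finsupp.induction_linear with
    | zero => simp
    | add y y' hy hy' => simp only [map_add, pair_add_right, hy, hy']
    | single u b => simp only [shift_single, pair_single, add_sub_add_right_eq_sub]

lemma refl_zero (s : ℤ × ℤ) : refl s 0 = 0 := by ext; simp

/-- Reflection negates differences of exponents and conjugates coefficients, so the two arguments
change places. -/
lemma pair_refl (s : ℤ × ℤ) (x y : Trig) : pair c (refl s x) (refl s y) = pair c y x := by
  induction x using Finsupp.induction_linear with
  | zero => simp [refl_zero]
  | add x x' hx hx' => simp only [refl_add, pair_add_left, pair_add_right, hx, hx']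
  | single t a =>
    induction y using Finsupp.induction_linear with
    | zero => simp [refl_zero]
    | add y y' hy hy' => simp only [refl_add, pair_add_left, pair_add_right, hy, hy']
    | single u b =>
      simp only [refl_single, pair_single, Complex.conj_conj, sub_sub_sub_cancel_left]; ring

variable {c}

lemma pair_congr {c' : ℤ × ℤ → ℂ} {a b a' b' : ℕ} {x y : Trig} (hx : x ∈ box a b)
    (hy : y ∈ box a' b') (h : ∀ s ∈ boxSet a b, ∀ t ∈ boxSet a' b', c (s - t) = c' (s - t)) :
    pair c x y = pair c' x y := by
  refine box_induction (P := fun x => pair c x y = pair c' x y) (by simp) ?_ ?_ hx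
  · intro x x' h h'
    rw [pair_add_left, pair_add_left, h, h']
  · intro s hs a
    refine box_induction (P := fun y => pair c (Finsupp.single s a) y =
      pair c' (Finsupp.single s a) y) (by simp) ?_ ?_ hy
    · intro x x' h h'
      rw [pair_add_right, pair_add_right, h, h']
    · intro t ht b
      rw [pair_single, pair_single, h s hs t ht]

end pair

/-- The moments `c` define an inner product on the Laurent polynomials. -/
structure IsPosDef (c : ℤ × ℤ → ℂ) : Prop where
  herm : ∀ s, c (-s) = conj (c s)
  pos : ∀ x : Trig, x ≠ 0 → 0 < (pair c x x).re

namespace IsPosDef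
variable {c : ℤ × ℤ → ℂ} (hc : IsPosDef c)
include hc

lemma pair_conj (x y : Trig) : conj (pair c x y) = pair c y x := by
  induction x using Finsupp.induction_linear with
  | zero => simp
  | add x x' hx hx' => simp only [map_add, pair_add_left, pair_add_right, hx, hx']
  | single t a =>
    induction y using Finsupp.induction_linear with
    | zero => simp
    | add y y' hy hy' => simp only [map_add, pair_add_left, pair_add_right, hy, hy']
    | single u b =>
      simp only [pair_single, map_mul, Complex.conj_conj]
      rw [← hc.herm, neg_sub]; ring

lemma pair_comm_zero {x y : Trig} (h : pair c x y = 0) : pair c y x = 0 := by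
  rw [← hc.pair_conj, h, map_zero]

lemma eq_zero {x : Trig} (h : pair c x x = 0) : x = 0 := by
  by_contra hx
  have := hc.pos x hx
  rw [h] at this
  simp at this

lemma pair_self (x : Trig) : pair c x x = ((pair c x x).re : ℂ) := by
  apply Complex.ext
  · simp
  · have := congrArg Complex.im (hc.pair_conj x x)
    simp only [Complex.conj_im] at this
    simp only [Complex.ofReal_im]
    linarith

/-- The inner product with moments `c`. -/
@[reducible] noncomputable def core : InnerProductSpace.Core ℂ Trig where
  -- Inner products in Mathlib are conjugate linear in the first argument, `pair` in the second.
  inner x y := pair c y x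
  conj_inner_symm x y := hc.pair_conj _ _
  re_inner_nonneg x := by
    by_cases h : x = 0
    · simp [h]
    · exact (hc.pos x h).le
  add_left x y z := pair_add_right _ _ _ _
  smul_left x y r := pair_smul_right _ _ _ _
  definite x h := hc.eq_zero h

end IsPosDef

end Bicircle

/-! ### Orthonormal families, extremal polynomials and the Christoffel–Darboux formula. -/

namespace Bicircle

open Finset
open scoped ComplexConjugate

/-- A family which is orthonormal for the form with moments `c`. -/
def OrthoFam {ι : Type*} (c : ℤ × ℤ → ℂ) (v : ι → Trig) : Prop :=
  (∀ i, pair c (v i) (v i) = 1) ∧ ∀ i j, i ≠ j → pair c (v i) (v j) = 0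

lemma IsPosDef.exists_orthoFam {c : ℤ × ℤ → ℂ} (hc : IsPosDef c) {W U : Submodule ℂ Trig}
    [Module.Finite ℂ W] [Module.Finite ℂ U] (h : W ≤ U) {d : ℕ}
    (hd : Module.finrank ℂ W + d = Module.finrank ℂ U) :
    ∃ v : Fin d → Trig, OrthoFam c v ∧ (∀ i, v i ∈ U) ∧ ∀ i, ∀ x ∈ W, pair c (v i) x = 0 := by
  let _ := hc.core.toNormedAddCommGroup
  let _ : InnerProductSpace ℂ Trig := InnerProductSpace.ofCore hc.core.toCore
  have hin : ∀ x y : Trig, inner ℂ x y = pair c y x := fun x y => rfl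
  have hfin : Module.Finite ℂ (Wᗮ ⊓ U : Submodule ℂ Trig) :=
    Submodule.finiteDimensional_of_le inf_le_right
  have e := Submodule.finrank_add_inf_finrank_orthogonal h
  have e2 : Module.finrank ℂ (Wᗮ ⊓ U : Submodule ℂ Trig) = d := by omega
  let b := (stdOrthonormalBasis ℂ (Wᗮ ⊓ U : Submodule ℂ Trig)).reindex (finCongr e2)
  refine ⟨fun i => b i, ⟨fun i => ?_, fun i j hij => ?_⟩, fun i => (b i).2.2, fun i x hx => ?_⟩
  · have := b.orthonormal.1 i
    rw [← hin]
    have h2 := inner_self_eq_norm_sq_to_K (𝕜 := ℂ) (b i : Trig)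
    have h3 : ‖(b i : Trig)‖ = 1 := this
    rw [h2, h3]
    simp
  · have := b.orthonormal.2 hij.symm
    rw [← hin]
    exact this
  · rw [← hin]
    exact (Submodule.mem_orthogonal W _).1 (b i).2.1 x hx

lemma OrthoFam.pair_sum {ι : Type*} [Fintype ι] {c : ℤ × ℤ → ℂ} {v : ι → Trig}
    (h : OrthoFam c v) (g : ι → ℂ) (j : ι) : pair c (∑ i, g i • v i) (v j) = g j := by
  rw [pair_sum_left, Finset.sum_eq_single j]
  · rw [pair_smul_left, h.1, mul_one]
  · intro i _ hij
    rw [pair_smul_left, h.2 i j hij, mul_zero]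
  · simp

lemma OrthoFam.linearIndependent {ι : Type*} [Fintype ι] {c : ℤ × ℤ → ℂ} {v : ι → Trig}
    (h : OrthoFam c v) : LinearIndependent ℂ v := by
  rw [Fintype.linearIndependent_iff]
  intro g hg j
  rw [← h.pair_sum g j, hg, pair_zero_left]

lemma OrthoFam.eq_sum {ι : Type*} [Fintype ι] {c : ℤ × ℤ → ℂ} {v : ι → Trig}
    (h : OrthoFam c v) {U : Submodule ℂ Trig} [Module.Finite ℂ U] (hv : ∀ i, v i ∈ U)
    (hcard : Fintype.card ι = Module.finrank ℂ U) {x : Trig} (hx : x ∈ U) :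
    x = ∑ i, pair c x (v i) • v i := by
  have hspan : Submodule.span ℂ (Set.range v) = U := by
    apply Submodule.eq_of_le_of_finrank_eq
    · rw [Submodule.span_le]
      rintro _ ⟨i, rfl⟩
      exact hv i
    · rw [finrank_span_eq_card h.linearIndependent, hcard]
  rw [← hspan, Submodule.mem_span_range_iff_exists_fun] at hx
  obtain ⟨g, rfl⟩ := hx
  refine Finset.sum_congr rfl fun j _ => ?_
  rw [h.pair_sum]

/-- The reproducing kernel of a finite-dimensional space does not depend on the orthonormal basis.
Applied to point evaluations and to a basis together with its reflection, this is the source of all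
kernel identities below. -/
lemma IsPosDef.kernel_unique {c : ℤ × ℤ → ℂ} (hc : IsPosDef c) {ι ι' : Type*} [Fintype ι]
    [Fintype ι'] {v : ι → Trig} {v' : ι' → Trig} (h : OrthoFam c v) (h' : OrthoFam c v')
    {U : Submodule ℂ Trig} [Module.Finite ℂ U] (hv : ∀ i, v i ∈ U) (hv' : ∀ i, v' i ∈ U)
    (hcard : Fintype.card ι = Module.finrank ℂ U) (hcard' : Fintype.card ι' = Module.finrank ℂ U)
    (k l : Trig →ₗ[ℂ] ℂ) :
    ∑ i, k (v i) * conj (l (v i)) = ∑ i, k (v' i) * conj (l (v' i)) := by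
  have e1 : ∀ i, k (v i) = ∑ j, pair c (v i) (v' j) * k (v' j) := fun i => by
    conv_lhs => rw [h'.eq_sum hv' hcard' (hv i)]
    simp [map_sum]
  have e2 : ∀ j, l (v' j) = ∑ i, pair c (v' j) (v i) * l (v i) := fun j => by
    conv_lhs => rw [h.eq_sum hv hcard (hv' j)]
    simp [map_sum]
  simp only [e1, e2, Finset.sum_mul, map_sum, map_mul, Finset.mul_sum, hc.pair_conj]
  rw [Finset.sum_comm]
  refine Finset.sum_congr rfl fun i _ => Finset.sum_congr rfl fun j _ => ?_
  ring

lemma IsPosDef.orthoFam_sum {c : ℤ × ℤ → ℂ} (hc : IsPosDef c) {ι ι' : Type*}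
    {v : ι → Trig} {v' : ι' → Trig} (h : OrthoFam c v) (h' : OrthoFam c v')
    (hvv : ∀ i j, pair c (v i) (v' j) = 0) : OrthoFam c (Sum.elim v v') := by
  refine ⟨?_, ?_⟩
  · rintro (i | i)
    exacts [h.1 i, h'.1 i]
  · rintro (i | i) (j | j) hij
    · exact h.2 i j (by rintro rfl; exact hij rfl)
    · exact hvv i j
    · exact hc.pair_comm_zero (hvv j i)
    · exact h'.2 i j (by rintro rfl; exact hij rfl)

lemma OrthoFam.refl {c : ℤ × ℤ → ℂ} {ι : Type*} {v : ι → Trig} (h : OrthoFam c v) (s : ℤ × ℤ) :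
    OrthoFam c (fun i => refl s (v i)) := by
  refine ⟨fun i => ?_, fun i j hij => ?_⟩
  · rw [pair_refl, h.1]
  · rw [pair_refl, h.2 j i hij.symm]

/-- The orthogonality of `box (n+1) m ⊖ box n m` and `box n (m+1) ⊖ box n m`. -/
def SplitOrth (c : ℤ × ℤ → ℂ) (n m : ℕ) : Prop :=
  ∀ x ∈ box (n + 1) m, ∀ y ∈ box n (m + 1), (∀ v ∈ box n m, pair c x v = 0) →
    (∀ v ∈ box n m, pair c y v = 0) → pair c x y = 0

/-- `p` is a unit vector of bidegree `(n, m)` orthogonal to all nonconstant monomials. -/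
structure IsExtremal (c : ℤ × ℤ → ℂ) (n m : ℕ) (p : Trig) : Prop where
  mem : p ∈ box (n + 1) (m + 1)
  norm : pair c p p = 1
  orth : ∀ s ∈ boxSet (n + 1) (m + 1), s ≠ 0 → pair c p (Finsupp.single s 1) = 0

lemma IsExtremal.pair_eq {c : ℤ × ℤ → ℂ} {n m : ℕ} {p : Trig} (hp : IsExtremal c n m p)
    {x : Trig} (hx : x ∈ box (n + 1) (m + 1)) :
    pair c p x = conj (x 0) * pair c p (Finsupp.single 0 1) := by
  refine box_induction (P := fun x => pair c p x = conj (x 0) * pair c p (Finsupp.single 0 1))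
    (by simp) ?_ ?_ hx
  · intro x y hx hy
    rw [pair_add_right, hx, hy, Finsupp.add_apply, map_add]; ring
  · intro s hs a
    have : Finsupp.single s a = a • Finsupp.single s (1 : ℂ) := by simp
    rw [this, pair_smul_right]
    by_cases h : s = 0
    · subst h; simp
    · rw [hp.orth s hs h]; simp [h]

lemma IsExtremal.pair_one {c : ℤ × ℤ → ℂ} {n m : ℕ} {p : Trig} (hp : IsExtremal c n m p) :
    conj (p 0) * pair c p (Finsupp.single 0 1) = 1 := by
  rw [← hp.pair_eq hp.mem, hp.norm]

/-- Removing the exponent `0` from the box lowers the dimension by one, so the orthogonal complement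
contains a unit vector. -/
lemma IsPosDef.exists_isExtremal {c : ℤ × ℤ → ℂ} (hc : IsPosDef c) (n m : ℕ) :
    ∃ p, IsExtremal c n m p := by
  set B := boxSet (n + 1) (m + 1) with hB
  set W : Submodule ℂ Trig := Finsupp.supported ℂ ℂ (B \ {0}) with hW
  have h0 : (0 : ℤ × ℤ) ∈ B := by rw [hB, mem_boxSet]; simp
  have hWU : W ≤ box (n + 1) (m + 1) := Finsupp.supported_mono Set.sdiff_subset
  have : Module.Finite ℂ W := Submodule.finiteDimensional_of_le hWU
  have hfin : (B \ {0}).Finite := (boxSet_finite _ _).subset Set.sdiff_subset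
  have hfW : Module.finrank ℂ W + 1 = Module.finrank ℂ (box (n + 1) (m + 1)) := by
    have hB' : (B \ {0}).ncard + 1 = B.ncard :=
      Set.ncard_sdiff_singleton_add_one h0 (boxSet_finite _ _)
    have e : ∀ S : Set (ℤ × ℤ), S.Finite →
        Module.finrank ℂ (Finsupp.supported ℂ ℂ S) = S.ncard := fun S hS => by
      classical
      rw [(Finsupp.supportedEquivFinsupp (M := ℂ) (R := ℂ) S).finrank_eq]
      have := hS.fintype
      rw [Module.finrank_finsupp_self, ← Nat.card_eq_fintype_card, Set.ncard_def,
        Set.encard, ENat.card_eq_coe_natCard, ENat.toNat_natCast]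
    rw [hW, e _ hfin, box, e _ (boxSet_finite _ _), hB']
  obtain ⟨v, hv, hvU, hvW⟩ := hc.exists_orthoFam hWU hfW
  refine ⟨v 0, hvU 0, hv.1 0, fun s hs hs0 => hvW 0 _ ?_⟩
  exact Finsupp.single_mem_supported ℂ _ ⟨hs, hs0⟩

lemma ev_refl_succ_left {a b : ℕ} {s : ℤ × ℤ} {x : Trig} (h : refl s x ∈ box a b) (z w : ℂ) :
    ev z w (refl (s.1 + 1, s.2) x) = z * ev z w (refl s x) := by
  have e : (s.1 + 1, s.2) = (((1 : ℕ) : ℤ), ((0 : ℕ) : ℤ)) + s := by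
    ext <;> simp [add_comm]
  rw [e, ← shift_refl, ev_shift h]; simp

lemma ev_refl_succ_right {a b : ℕ} {s : ℤ × ℤ} {x : Trig} (h : refl s x ∈ box a b) (z w : ℂ) :
    ev z w (refl (s.1, s.2 + 1) x) = w * ev z w (refl s x) := by
  have e : (s.1, s.2 + 1) = (((0 : ℕ) : ℤ), ((1 : ℕ) : ℤ)) + s := by
    ext <;> simp [add_comm]
  rw [e, ← shift_refl, ev_shift h]; simp

/-- The Christoffel–Darboux formula under the splitting condition. -/
theorem IsPosDef.christoffel_darboux {c : ℤ × ℤ → ℂ} (hc : IsPosDef c) {n m : ℕ}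
    (hK : SplitOrth c n m) {p : Trig} (hp : IsExtremal c n m p) :
    ∃ (ε : Fin m → Trig) (ψ : Fin n → Trig), OrthoFam c ψ ∧ (∀ k, ψ k ∈ box n (m + 1)) ∧
      (∀ k, ∀ x ∈ box n m, pair c (ψ k) (shift (0, 1) x) = 0) ∧
      ∀ z w z' w' : ℂ, ev z w p * conj (ev z' w' p) -
        ev z w (refl (n, m) p) * conj (ev z' w' (refl (n, m) p)) =
        (1 - w * conj w') * ∑ k, ev z w (ε k) * conj (ev z' w' (ε k)) +
        (1 - z * conj z') * ∑ k, ev z w (ψ k) * conj (ev z' w' (ψ k)) := by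
  -- Bases of `box n m` and of the two complements in `SplitOrth`. With `q` they have `nm + m + n +
  -- 1` elements, the dimension of the full box.
  obtain ⟨a, ha, haU, -⟩ := hc.exists_orthoFam (W := ⊥) (U := box n m) bot_le
    (d := n * m) (by rw [finrank_bot, finrank_box, zero_add])
  obtain ⟨ε, hε, hεU, hεW⟩ := hc.exists_orthoFam (W := box n m) (U := box (n + 1) m)
    (box_mono (by omega) le_rfl) (d := m) (by rw [finrank_box, finrank_box]; ring)
  obtain ⟨φ, hφ, hφU, hφW⟩ := hc.exists_orthoFam (W := box n m) (U := box n (m + 1))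
    (box_mono le_rfl (by omega)) (d := n) (by rw [finrank_box, finrank_box]; ring)
  set a' : Fin (n * m) → Trig := fun i => refl (n - 1, m - 1) (a i) with ha'
  set ε' : Fin m → Trig := fun i => refl (n, m - 1) (ε i) with hε'
  set ψ : Fin n → Trig := fun i => refl (n - 1, m) (φ i) with hψ
  set q := refl (n, m) p with hq
  have ha'U : ∀ i, a' i ∈ box n m := fun i =>
    refl_mem_box (haU i) (by simp) (by simp) (by simp) (by simp)
  have hε'U : ∀ i, ε' i ∈ box (n + 1) m := fun i =>
    refl_mem_box (hεU i) (by simp) (by simp) (by simp) (by simp)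
  have hψU : ∀ i, ψ i ∈ box n (m + 1) := fun i =>
    refl_mem_box (hφU i) (by simp) (by simp) (by simp) (by simp)
  have hqU : q ∈ box (n + 1) (m + 1) :=
    refl_mem_box hp.mem (by simp) (by simp) (by simp) (by simp)
  -- Reflecting the extremal property: `q` is orthogonal to every monomial of the box except the top
  -- one `z^n w^m`.
  have horth : ∀ x ∈ box (n + 1) (m + 1), x (n, m) = 0 → pair c x q = 0 := by
    intro x hx h0
    have h1 := pair_refl c (n, m) q x
    rw [← h1, hq, refl_refl, hp.pair_eq (refl_mem_box hx (by simp) (by simp) (by simp) (by simp))]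
    simp only [refl_apply, sub_zero, h0, map_zero, zero_mul]
  have hnm : ∀ {i j : ℕ} {x : Trig}, x ∈ box i j → i ≤ n ∨ j ≤ m → x (n, m) = 0 := by
    intro i j x hx hij
    apply mem_box.1 hx
    simp only [mem_boxSet]
    omega
  have hae : OrthoFam c (Sum.elim a ε) :=
    hc.orthoFam_sum ha hε fun i j => hc.pair_comm_zero (hεW j _ (haU i))
  have haf : OrthoFam c (Sum.elim a φ) :=
    hc.orthoFam_sum ha hφ fun i j => hc.pair_comm_zero (hφW j _ (haU i))
  -- The splitting condition is exactly the orthogonality of `ε` and `φ`.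
  have haef : OrthoFam c (Sum.elim (Sum.elim a ε) φ) := by
    refine hc.orthoFam_sum hae hφ ?_
    rintro (i | i) j
    · exact hc.pair_comm_zero (hφW j _ (haU i))
    · exact hK _ (hεU i) _ (hφU j) (hεW i) (hφW j)
  have hqF : OrthoFam c (fun _ : Unit => q) :=
    ⟨fun _ => by rw [hq, pair_refl, hp.norm], fun i j hij => (hij rfl).elim⟩
  have ba : ∀ {x}, x ∈ box n m → x ∈ box (n + 1) (m + 1) := fun h =>
    box_mono (by omega) (by omega) h
  have be : ∀ {x}, x ∈ box (n + 1) m → x ∈ box (n + 1) (m + 1) := fun h =>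
    box_mono (by omega) (by omega) h
  have bf : ∀ {x}, x ∈ box n (m + 1) → x ∈ box (n + 1) (m + 1) := fun h =>
    box_mono (by omega) (by omega) h
  have hall : OrthoFam c (Sum.elim (Sum.elim (Sum.elim a ε) φ) (fun _ : Unit => q)) := by
    refine hc.orthoFam_sum haef hqF ?_
    rintro ((i | i) | i) -
    · exact horth _ (ba (haU i)) (hnm (haU i) (by simp))
    · exact horth _ (be (hεU i)) (hnm (hεU i) (by simp))
    · exact horth _ (bf (hφU i)) (hnm (hφU i) (by simp))
  refine ⟨ε, ψ, hφ.refl _, hψU, ?_, ?_⟩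
  · intro k x hx
    have e : shift (0, 1) x = refl (n - 1, m) (refl (n - 1, m - 1) x) := by
      have : ((n : ℤ) - 1, (m : ℤ)) = (0, 1) + ((n : ℤ) - 1, (m : ℤ) - 1) := by simp
      rw [this, ← shift_refl, refl_refl]
    rw [e, hψ, pair_refl]
    exact hc.pair_comm_zero (hφW k _ (refl_mem_box hx (by simp) (by simp) (by simp) (by simp)))
  · intro z w z' w'
    -- Reflecting with respect to a larger box only adds a factor `z` or `w`.
    have s1 : ∀ x ∈ box n m, ∀ z w : ℂ, ev z w (refl (n, m - 1) x) =
        z * ev z w (refl (n - 1, m - 1) x) := fun x hx z w => by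
      simpa using ev_refl_succ_left (s := ((n : ℤ) - 1, (m : ℤ) - 1)) (a := n) (b := m)
        (refl_mem_box hx (by simp) (by simp) (by simp) (by simp)) z w
    have s2 : ∀ x ∈ box n m, ∀ z w : ℂ, ev z w (refl (n - 1, m) x) =
        w * ev z w (refl (n - 1, m - 1) x) := fun x hx z w => by
      simpa using ev_refl_succ_right (s := ((n : ℤ) - 1, (m : ℤ) - 1)) (a := n) (b := m)
        (refl_mem_box hx (by simp) (by simp) (by simp) (by simp)) z w
    have s3 : ∀ x ∈ box (n + 1) m, ∀ z w : ℂ, ev z w (refl (n, m) x) =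
        w * ev z w (refl (n, m - 1) x) := fun x hx z w => by
      simpa using ev_refl_succ_right (s := ((n : ℤ), (m : ℤ) - 1)) (a := n + 1) (b := m)
        (refl_mem_box hx (by simp) (by simp) (by simp) (by simp)) z w
    have s4 : ∀ x ∈ box n (m + 1), ∀ z w : ℂ, ev z w (refl (n, m) x) =
        z * ev z w (refl (n - 1, m) x) := fun x hx z w => by
      simpa using ev_refl_succ_left (s := ((n : ℤ) - 1, (m : ℤ))) (a := n) (b := m + 1)
        (refl_mem_box hx (by simp) (by simp) (by simp) (by simp)) z w
    -- In each of the four boxes the kernel of the chosen basis equals that of its reflection. In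
    -- the full box the reflected basis consists of `z w a'`, `w ε'`, `z ψ` and `p`.
    have k1 := hc.kernel_unique hall (hall.refl (n, m)) (U := box (n + 1) (m + 1))
      (by rintro (((i | i) | i) | i)
          exacts [ba (haU i), be (hεU i), bf (hφU i), hqU])
      (by
        rintro (((i | i) | i) | i)
        exacts [refl_mem_box (ba (haU i)) (by simp) (by simp) (by simp) (by simp),
          refl_mem_box (be (hεU i)) (by simp) (by simp) (by simp) (by simp),
          refl_mem_box (bf (hφU i)) (by simp) (by simp) (by simp) (by simp),
          refl_mem_box hqU (by simp) (by simp) (by simp) (by simp)])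
      (by rw [finrank_box]; simp; ring) (by rw [finrank_box]; simp; ring) (ev z w) (ev z' w')
    have k2 := hc.kernel_unique hae (hae.refl (n, m - 1)) (U := box (n + 1) m)
      (by rintro (i | i)
          exacts [box_mono (by omega) (by omega) (haU i), hεU i])
      (by
        rintro (i | i)
        exacts [refl_mem_box (haU i) (by simp) (by simp) (by simp) (by simp),
          refl_mem_box (hεU i) (by simp) (by simp) (by simp) (by simp)])
      (by rw [finrank_box]; simp; ring) (by rw [finrank_box]; simp; ring) (ev z w) (ev z' w')
    have k3 := hc.kernel_unique haf (haf.refl (n - 1, m)) (U := box n (m + 1))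
      (by rintro (i | i)
          exacts [box_mono (by omega) (by omega) (haU i), hφU i])
      (by
        rintro (i | i)
        exacts [refl_mem_box (haU i) (by simp) (by simp) (by simp) (by simp),
          refl_mem_box (hφU i) (by simp) (by simp) (by simp) (by simp)])
      (by rw [finrank_box]; simp; ring) (by rw [finrank_box]; simp; ring) (ev z w) (ev z' w')
    have k4 := hc.kernel_unique ha (ha.refl (n - 1, m - 1)) haU ha'U
      (by rw [finrank_box]; simp) (by rw [finrank_box]; simp) (ev z w) (ev z' w')
    have ea : ∀ i z w, ev z w (refl (n, m) (a i)) = z * w * ev z w (a' i) := fun i z w => by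
      rw [s3 _ (box_mono (by omega) le_rfl (haU i)), s1 _ (haU i)]; ring
    simp only [Fintype.sum_sum_type, Sum.elim_inl, Sum.elim_inr, Finset.univ_unique,
      Finset.sum_singleton] at k1 k2 k3
    simp only [ea, s3 _ (hεU _), s4 _ (hφU _), hq, refl_refl] at k1
    simp only [s1 _ (haU _)] at k2
    simp only [s2 _ (haU _)] at k3
    have f1 : ∀ {d : ℕ} (u : Fin d → Trig) (α α' : ℂ),
        ∑ i, α * ev z w (u i) * conj (α' * ev z' w' (u i)) =
          α * conj α' * ∑ i, ev z w (u i) * conj (ev z' w' (u i)) := by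
      intro d u α α'
      rw [Finset.mul_sum]
      refine Finset.sum_congr rfl fun i _ => ?_
      rw [map_mul]; ring
    rw [f1 (fun i => refl (n, m - 1) (ε i)), f1 (fun i => refl (n - 1, m) (φ i)), f1 a'] at k1
    rw [f1 (fun i => refl (n - 1, m - 1) (a i))] at k2 k3
    simp only [hψ, hq, ha', map_mul] at *
    -- The smaller boxes eliminate the kernels of `ε'`, `φ` and `a'`.
    linear_combination -k1 + w * conj w' * k2 + k3 - w * conj w' * k4
end Bicircle

/-! ### Stability of the extremal polynomial. -/

namespace Bicircle

open Finset
open scoped ComplexConjugate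

lemma ev_eq_sum {a b : ℕ} {x : Trig} (hx : x ∈ box a b) (z w : ℂ) :
    ev z w x = ∑ i : Fin a, ∑ j : Fin b, x ((i : ℕ), (j : ℕ)) * (z ^ (i : ℕ) * w ^ (j : ℕ)) := by
  classical
  refine box_induction (P := fun x => ev z w x =
    ∑ i : Fin a, ∑ j : Fin b, x ((i : ℕ), (j : ℕ)) * (z ^ (i : ℕ) * w ^ (j : ℕ)))
    (by simp) ?_ ?_ hx
  · intro x y hx hy
    rw [map_add, hx, hy, ← Finset.sum_add_distrib]
    refine Finset.sum_congr rfl fun i _ => ?_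
    rw [← Finset.sum_add_distrib]
    refine Finset.sum_congr rfl fun j _ => ?_
    rw [Finsupp.add_apply]; ring
  · rintro ⟨k, l⟩ hs c
    obtain ⟨⟨h1, h1'⟩, h2, h2'⟩ := mem_boxSet.1 hs
    obtain ⟨k, rfl⟩ := Int.eq_ofNat_of_zero_le h1
    obtain ⟨l, rfl⟩ := Int.eq_ofNat_of_zero_le h2
    simp only [Nat.cast_lt] at h1' h2'
    rw [Finset.sum_eq_single (⟨k, h1'⟩ : Fin a), Finset.sum_eq_single (⟨l, h2'⟩ : Fin b)]
    · simp [ev_single]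
    · intro j _ hj
      have : (l : ℤ) ≠ (j : ℕ) := by
        intro h; apply hj; ext; simp; omega
      simp [this]
    · simp
    · intro i _ hi
      have : (k : ℤ) ≠ (i : ℕ) := by
        intro h; apply hi; ext; simp; omega
      simp [this]
    · simp

lemma coeff_eq_zero_of_forall_sum {n : ℕ} {a : Fin n → ℂ}
    (h : ∀ z : ℂ, ‖z‖ < 1 → ∑ i, a i * z ^ (i : ℕ) = 0) : a = 0 := by
  set P : Polynomial ℂ := ∑ i : Fin n, Polynomial.C (a i) * Polynomial.X ^ (i : ℕ) with hP
  have h0 : P = 0 := by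
    apply Polynomial.eq_zero_of_infinite_isRoot
    refine Set.Infinite.mono (s := Metric.ball (0 : ℂ) 1) ?_
      (infinite_of_mem_nhds 0 (Metric.ball_mem_nhds 0 one_pos))
    intro z hz
    rw [mem_ball_zero_iff] at hz
    simpa [Polynomial.IsRoot, hP, Polynomial.eval_finsetSum] using h z hz
  funext i
  have := congrArg (fun Q => Polynomial.coeff Q i) h0
  simp only [hP, Polynomial.finsetSum_coeff, Polynomial.coeff_C_mul, Polynomial.coeff_X_pow,
    Polynomial.coeff_zero] at this
  rw [Finset.sum_eq_single i] at this
  · simpa using this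
  · intro j _ hj
    rw [if_neg (fun h => hj (Fin.ext h.symm)), mul_zero]
  · simp

lemma ev_eq_sum_mul {a b : ℕ} {x : Trig} (hx : x ∈ box a b) (z w : ℂ) :
    ev z w x = ∑ i : Fin a, (∑ j : Fin b, x ((i : ℕ), (j : ℕ)) * w ^ (j : ℕ)) * z ^ (i : ℕ) := by
  rw [ev_eq_sum hx]
  refine Finset.sum_congr rfl fun i _ => ?_
  rw [Finset.sum_mul]
  exact Finset.sum_congr rfl fun j _ => by ring

lemma ev_eq_zero_of_ball {a b : ℕ} {x : Trig} (hx : x ∈ box a b) {w : ℂ}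
    (h : ∀ z : ℂ, ‖z‖ < 1 → ev z w x = 0) (z : ℂ) : ev z w x = 0 := by
  have := coeff_eq_zero_of_forall_sum (n := a)
    (a := fun i => ∑ j : Fin b, x ((i : ℕ), (j : ℕ)) * w ^ (j : ℕ))
    (fun z hz => by rw [← ev_eq_sum_mul hx, h z hz])
  rw [ev_eq_sum_mul hx]
  exact Finset.sum_eq_zero fun i _ => by rw [congrFun this i]; simp

/-- Division with remainder by the linear polynomial with root `w`, in the second variable; the
remainder depends on the first variable alone. -/
lemma exists_sub_mem_box_one {n m : ℕ} (w : ℂ) {x : Trig} (hx : x ∈ box n (m + 1)) :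
    ∃ h ∈ box n m, x - (shift (0, 1) h - w • h) ∈ box n 1 := by
  refine box_induction (P := fun x => ∃ h ∈ box n m, x - (shift (0, 1) h - w • h) ∈ box n 1)
    ⟨0, zero_mem _, by simp⟩ ?_ ?_ hx
  · rintro x y ⟨h, h1, h2⟩ ⟨k, k1, k2⟩
    refine ⟨h + k, add_mem h1 k1, ?_⟩
    have : x + y - (shift (0, 1) (h + k) - w • (h + k)) =
      (x - (shift (0, 1) h - w • h)) + (y - (shift (0, 1) k - w • k)) := by
      rw [map_add, smul_add]; abel
    rw [this]
    exact add_mem h2 k2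
  · rintro ⟨i, l⟩ hs c
    obtain ⟨⟨h1, h1'⟩, h2, h2'⟩ := mem_boxSet.1 hs
    obtain ⟨l, rfl⟩ := Int.eq_ofNat_of_zero_le h2
    simp only [Nat.cast_lt] at h1 h1' h2'
    clear hs h2
    induction l with
    | zero => exact ⟨0, zero_mem _, by
        simpa using single_mem_box (mem_boxSet.2 ⟨⟨h1, h1'⟩, by simp⟩) c⟩
    | succ l ih =>
      obtain ⟨h, hm, hh⟩ := ih (by omega)
      have hl : Finsupp.single (i, (l : ℤ)) c ∈ box n m :=
        single_mem_box (mem_boxSet.2 ⟨⟨h1, h1'⟩, by simp; omega⟩) c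
      refine ⟨Finsupp.single (i, (l : ℤ)) c + w • h,
        add_mem hl (Submodule.smul_mem _ _ hm), ?_⟩
      have : Finsupp.single (i, ((l + 1 : ℕ) : ℤ)) c - (shift (0, 1)
          (Finsupp.single (i, (l : ℤ)) c + w • h) - w • (Finsupp.single (i, (l : ℤ)) c + w • h)) =
          w • (Finsupp.single (i, (l : ℤ)) c - (shift (0, 1) h - w • h)) := by
        rw [map_add, map_smul, shift_single]
        simp only [Prod.mk_add_mk, add_zero, Nat.cast_add, Nat.cast_one, smul_sub, smul_add]
        abel
      rw [this]
      exact Submodule.smul_mem _ _ hh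

lemma eq_shift_sub_smul {n m : ℕ} {w : ℂ} {x : Trig} (hx : x ∈ box n (m + 1))
    (h0 : ∀ z, ev z w x = 0) : ∃ h ∈ box n m, x = shift (0, 1) h - w • h := by
  obtain ⟨h, hm, hr⟩ := exists_sub_mem_box_one w hx
  refine ⟨h, hm, sub_eq_zero.1 ?_⟩
  set r := x - (shift (0, 1) h - w • h) with hrdef
  have hev : ∀ z, ev z w r = 0 := fun z => by
    have := ev_shift hm z w 0 1
    simp only [Nat.cast_zero, Nat.cast_one, pow_zero, pow_one, one_mul] at this
    rw [hrdef, map_sub, map_sub, h0, this, map_smul]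
    simp
  have hz := coeff_eq_zero_of_forall_sum (n := n)
    (a := fun i => ∑ j : Fin 1, r ((i : ℕ), (j : ℕ)) * w ^ (j : ℕ))
    (fun z _ => by rw [← ev_eq_sum_mul hr, hev z])
  ext ⟨i, j⟩
  by_cases hs : (i, j) ∈ boxSet n 1
  · obtain ⟨⟨h1, h1'⟩, h2, h2'⟩ := mem_boxSet.1 hs
    simp only at h1 h1' h2 h2'
    obtain ⟨i, rfl⟩ := Int.eq_ofNat_of_zero_le h1
    obtain rfl : j = 0 := by omega
    simpa using congrFun hz ⟨i, by omega⟩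
  · exact mem_box.1 hr _ hs

/-- If `x` vanished identically on the line through `w₀`, then `x = (w - w₀) h`. Orthogonality of
`x` to `w h` turns `‖x‖²` into `(|w₀|² - 1) ‖h‖²`, which is not positive for `|w₀| ≤ 1`. -/
lemma IsPosDef.exists_ev_ne_zero {c : ℤ × ℤ → ℂ} (hc : IsPosDef c) {n m : ℕ} {x : Trig}
    (hx : x ∈ box n (m + 1)) (hx0 : x ≠ 0)
    (horth : ∀ h ∈ box n m, pair c x (shift (0, 1) h) = 0) {w : ℂ} (hw : ‖w‖ ≤ 1) :
    ∃ z, ev z w x ≠ 0 := by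
  by_contra! hcon
  obtain ⟨h, hm, rfl⟩ := eq_shift_sub_smul hx hcon
  have h1 := horth h hm
  rw [pair_sub_left, pair_shift, pair_smul_left] at h1
  have h2 : conj (pair c h h - w * pair c h (shift (0, 1) h)) = 0 := by rw [h1, map_zero]
  rw [map_sub, map_mul, hc.pair_conj, hc.pair_conj] at h2
  have hpos := hc.pos _ hx0
  have e : pair c (shift (0, 1) h - w • h) (shift (0, 1) h - w • h) =
      (w * conj w - 1) * pair c h h := by
    rw [pair_sub_left, pair_sub_right, pair_sub_right, pair_shift, pair_smul_left, pair_smul_right,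
      pair_smul_left, pair_smul_right]
    linear_combination h1 + h2
  rw [e, hc.pair_self h, Complex.mul_conj, ← Complex.ofReal_one, ← Complex.ofReal_sub,
    ← Complex.ofReal_mul, Complex.ofReal_re, Complex.normSq_eq_norm_sq] at hpos
  have hN : 0 ≤ (pair c h h).re := by
    by_cases hh : h = 0
    · simp [hh]
    · exact (hc.pos h hh).le
  have : ‖w‖ ^ 2 - 1 ≤ 0 := by nlinarith [norm_nonneg w]
  nlinarith

/-- The matrix whose rows are the coefficients in the first variable of the `ψ k`, as
polynomials in the second variable. -/
noncomputable def matPoly (n m : ℕ) (ψ : Fin n → Trig) : Matrix (Fin n) (Fin n) (Polynomial ℂ) :=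
  Matrix.of fun k i => ∑ j : Fin (m + 1),
    Polynomial.C (ψ k ((i : ℕ), (j : ℕ))) * Polynomial.X ^ (j : ℕ)

lemma ev_eq_matPoly {n m : ℕ} {ψ : Fin n → Trig} (hψ : ∀ k, ψ k ∈ box n (m + 1)) (z w : ℂ)
    (k : Fin n) : ev z w (ψ k) = ∑ i, (matPoly n m ψ k i).eval w * z ^ (i : ℕ) := by
  rw [ev_eq_sum_mul (hψ k)]
  refine Finset.sum_congr rfl fun i _ => ?_
  simp [matPoly, Polynomial.eval_finsetSum]

/-- A vector in the left kernel at `w` would give a nonzero combination of the `ψ k` vanishing for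
all `z` at that `w`, contrary to `exists_ev_ne_zero`. -/
lemma IsPosDef.det_matPoly_ne_zero {c : ℤ × ℤ → ℂ} (hc : IsPosDef c) {n m : ℕ}
    {ψ : Fin n → Trig} (hO : OrthoFam c ψ) (hψ : ∀ k, ψ k ∈ box n (m + 1))
    (horth : ∀ k, ∀ x ∈ box n m, pair c (ψ k) (shift (0, 1) x) = 0) {w : ℂ} (hw : ‖w‖ ≤ 1) :
    (matPoly n m ψ).det.eval w ≠ 0 := by
  intro h0
  have h1 : ((Polynomial.evalRingHom w).mapMatrix (matPoly n m ψ)).det = 0 := by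
    rw [← RingHom.map_det]; exact h0
  obtain ⟨v, hv, hv0⟩ := Matrix.exists_vecMul_eq_zero_iff.2 h1
  have hx0 : ∑ k, v k • ψ k ≠ 0 := fun h =>
    hv (funext (Fintype.linearIndependent_iff.1 hO.linearIndependent v h))
  obtain ⟨z, hz⟩ := hc.exists_ev_ne_zero (n := n) (m := m)
    (sum_mem fun k _ => Submodule.smul_mem _ _ (hψ k)) hx0
    (fun h hm => by
      rw [pair_sum_left]
      exact Finset.sum_eq_zero fun k _ => by rw [pair_smul_left, horth k h hm, mul_zero]) hw
  apply hz
  simp only [map_sum, map_smul, ev_eq_matPoly hψ, smul_eq_mul, Finset.mul_sum]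
  rw [Finset.sum_comm]
  refine Finset.sum_eq_zero fun i _ => ?_
  have := congrFun hv0 i
  simp only [Matrix.vecMul, dotProduct, RingHom.mapMatrix_apply, Matrix.map_apply,
    Polynomial.coe_evalRingHom, Pi.zero_apply] at this
  simp only [← mul_assoc, ← Finset.sum_mul, this, zero_mul]

/-- A common zero would put the nonzero vector `(1, z, …, z^(n-1))` in the kernel of the coefficient
matrix. -/
lemma exists_ev_ne_zero_of_det {n m : ℕ} (hn : 0 < n) {ψ : Fin n → Trig}
    (hψ : ∀ k, ψ k ∈ box n (m + 1)) {w : ℂ} (hdet : (matPoly n m ψ).det.eval w ≠ 0) (z : ℂ) :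
    ∃ k, ev z w (ψ k) ≠ 0 := by
  by_contra! hcon
  apply hdet
  have h1 : ((Polynomial.evalRingHom w).mapMatrix (matPoly n m ψ)).det = 0 := by
    refine Matrix.exists_mulVec_eq_zero_iff.1 ⟨fun i => z ^ (i : ℕ), ?_, ?_⟩
    · intro h
      have := congrFun h ⟨0, hn⟩
      simp at this
    · funext k
      rw [Pi.zero_apply, ← hcon k, ev_eq_matPoly hψ]
      simp [Matrix.mulVec, dotProduct]
  rw [← RingHom.map_det] at h1
  exact h1

lemma IsPosDef.ev_ne_zero_of_left {c : ℤ × ℤ → ℂ} (hc : IsPosDef c) {n m : ℕ} (hn : 0 < n)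
    (hK : SplitOrth c n m) {p : Trig} (hp : IsExtremal c n m p) {z w : ℂ}
    (hw : ‖w‖ ≤ 1) (hzw : ‖z‖ < 1 ∨ ‖z‖ = 1 ∧ ‖w‖ = 1) : ev z w p ≠ 0 := by
  obtain ⟨ε, ψ, hO, hψ, horth, hCD⟩ := hc.christoffel_darboux hK hp
  have hdet := hc.det_matPoly_ne_zero hO hψ horth hw
  obtain ⟨k, hk⟩ := exists_ev_ne_zero_of_det hn hψ hdet z
  intro h0
  have hsum : ∀ {d : ℕ} (u : Fin d → Trig), ∑ k, ev z w (u k) * conj (ev z w (u k)) =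
      ((∑ k, ‖ev z w (u k)‖ ^ 2 : ℝ) : ℂ) := fun u => by
    push_cast
    exact Finset.sum_congr rfl fun k _ => Complex.mul_conj' _
  have hpos : 0 < ∑ k, ‖ev z w (ψ k)‖ ^ 2 :=
    Finset.sum_pos' (fun i _ => by positivity) ⟨k, mem_univ k, by positivity⟩
  rcases hzw with hz | ⟨hz, hw1⟩
  -- On the diagonal, a zero of `p` makes the left side `-|q|² ≤ 0`, while the right side is
  -- positive because of the `ψ` term.
  · have h1 := hCD z w z w
    rw [h0, zero_mul, zero_sub, hsum, hsum, Complex.mul_conj', Complex.mul_conj',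
      Complex.mul_conj'] at h1
    have h2 : -‖ev z w (refl (n, m) p)‖ ^ 2 = (1 - ‖w‖ ^ 2) * ∑ k, ‖ev z w (ε k)‖ ^ 2 +
        (1 - ‖z‖ ^ 2) * ∑ k, ‖ev z w (ψ k)‖ ^ 2 := by exact_mod_cast h1
    have h3 : 0 ≤ 1 - ‖w‖ ^ 2 := by nlinarith [norm_nonneg w]
    have h4 : 0 < 1 - ‖z‖ ^ 2 := by nlinarith [norm_nonneg z]
    have h5 : 0 ≤ ∑ k, ‖ev z w (ε k)‖ ^ 2 := Finset.sum_nonneg fun i _ => by positivity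
    have := mul_pos h4 hpos
    have := mul_nonneg h3 h5
    nlinarith [sq_nonneg ‖ev z w (refl (n, m) p)‖]
  · have hq : ev z w (refl (n, m) p) = 0 := by rw [ev_refl hz hw1, h0, map_zero, mul_zero]
    have hww : w * conj w = 1 := by rw [Complex.mul_conj', hw1]; simp
    -- On the torus `q` vanishes with `p`, and the `ε` term is absent since `|w| = 1`. So the `ψ`
    -- kernel vanishes for `|z'| < 1`, and, being polynomial in `z'`, also at `z' = z`, where it is
    -- a sum of squares.
    set x : Trig := ∑ k, conj (ev z w (ψ k)) • ψ k with hx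
    have hxm : x ∈ box n (m + 1) := sum_mem fun k _ => Submodule.smul_mem _ _ (hψ k)
    have hball : ∀ z' : ℂ, ‖z'‖ < 1 → ev z' w x = 0 := by
      intro z' hz'
      have h1 := hCD z w z' w
      rw [h0, hq, hww, zero_mul, zero_mul, sub_self, sub_self, zero_mul, zero_add] at h1
      have hne : 1 - z * conj z' ≠ 0 := by
        intro h
        have : ‖z * conj z'‖ = 1 := by rw [← sub_eq_zero.1 h]; simp
        rw [norm_mul, hz, one_mul, Complex.norm_conj] at this
        linarith
      have h2 := (mul_eq_zero.1 h1.symm).resolve_left hne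
      have h3 := congrArg conj h2
      simpa [hx, map_sum] using h3
    have h4 := ev_eq_zero_of_ball hxm hball z
    have h5 : ev z w x = ((∑ k, ‖ev z w (ψ k)‖ ^ 2 : ℝ) : ℂ) := by
      rw [← hsum, hx, map_sum]
      exact Finset.sum_congr rfl fun k _ => by rw [map_smul, smul_eq_mul, mul_comm]
    rw [h5] at h4
    exact hpos.ne' (by exact_mod_cast h4)

/-- Interchange of the two variables. -/
noncomputable def swapT : Trig →ₗ[ℂ] Trig :=
  (Finsupp.domLCongr (Equiv.prodComm ℤ ℤ)).toLinearMap

@[simp] lemma swapT_apply (x : Trig) (s : ℤ × ℤ) : swapT x s = x s.swap := by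
  simp [swapT, Finsupp.domLCongr_apply]

@[simp] lemma swapT_single (s : ℤ × ℤ) (a : ℂ) :
    swapT (Finsupp.single s a) = Finsupp.single s.swap a := by
  simp [swapT]

@[simp] lemma swapT_swapT (x : Trig) : swapT (swapT x) = x := by ext; simp

lemma swapT_mem_box {a b : ℕ} {x : Trig} (hx : x ∈ box a b) : swapT x ∈ box b a := by
  rw [mem_box] at *
  intro s hs
  rw [swapT_apply]
  apply hx
  simp only [mem_boxSet, Prod.fst_swap, Prod.snd_swap] at *
  tauto

lemma ev_swapT (z w : ℂ) (x : Trig) : ev z w (swapT x) = ev w z x := by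
  induction x using Finsupp.induction_linear with
  | zero => simp
  | add x y hx hy => rw [map_add, map_add, hx, hy, map_add]
  | single t a => rw [swapT_single, ev_single, ev_single, Prod.fst_swap, Prod.snd_swap]; ring

lemma pair_swapT (c : ℤ × ℤ → ℂ) (x y : Trig) :
    pair (fun s => c s.swap) (swapT x) (swapT y) = pair c x y := by
  induction x using Finsupp.induction_linear with
  | zero => simp
  | add x x' hx hx' => simp only [map_add, pair_add_left, hx, hx']
  | single t a =>
    induction y using Finsupp.induction_linear with
    | zero => simp
    | add y y' hy hy' => simp only [map_add, pair_add_right, hy, hy']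
    | single u b => simp only [swapT_single, pair_single, ← Prod.swap_sub, Prod.swap_swap]

lemma pair_swapT' (c : ℤ × ℤ → ℂ) (x y : Trig) :
    pair (fun s => c s.swap) x y = pair c (swapT x) (swapT y) := by
  rw [← pair_swapT c, swapT_swapT, swapT_swapT]

lemma IsPosDef.swap {c : ℤ × ℤ → ℂ} (hc : IsPosDef c) : IsPosDef fun s => c s.swap where
  herm s := by rw [Prod.swap_neg, hc.herm]
  pos x hx := by
    rw [pair_swapT']
    apply hc.pos
    intro h
    apply hx
    rw [← swapT_swapT x, h, map_zero]

lemma SplitOrth.swap {c : ℤ × ℤ → ℂ} (hc : IsPosDef c) {n m : ℕ} (h : SplitOrth c n m) :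
    SplitOrth (fun s => c s.swap) m n := by
  intro x hx y hy hxv hyv
  rw [pair_swapT']
  apply hc.pair_comm_zero
  refine h _ (swapT_mem_box hy) _ (swapT_mem_box hx) (fun v hv => ?_) (fun v hv => ?_)
  · have := hyv _ (swapT_mem_box hv)
    rwa [pair_swapT', swapT_swapT] at this
  · have := hxv _ (swapT_mem_box hv)
    rwa [pair_swapT', swapT_swapT] at this

lemma IsExtremal.swap {c : ℤ × ℤ → ℂ} {n m : ℕ} {p : Trig} (h : IsExtremal c n m p) :
    IsExtremal (fun s => c s.swap) m n (swapT p) where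
  mem := swapT_mem_box h.mem
  norm := by rw [pair_swapT, h.norm]
  orth s hs hs0 := by
    rw [pair_swapT', swapT_swapT, swapT_single]
    apply h.orth
    · simp only [mem_boxSet, Prod.fst_swap, Prod.snd_swap] at *
      tauto
    · rintro h0
      apply hs0
      rw [← Prod.swap_swap s, h0]; rfl

/-- Under the splitting condition the extremal polynomial is stable. -/
theorem IsPosDef.ev_ne_zero {c : ℤ × ℤ → ℂ} (hc : IsPosDef c) {n m : ℕ}
    (hK : SplitOrth c n m) {p : Trig} (hp : IsExtremal c n m p) {z w : ℂ}
    (hz : ‖z‖ ≤ 1) (hw : ‖w‖ ≤ 1) : ev z w p ≠ 0 := by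
  have hl : ∀ {z w : ℂ}, 0 < n → ‖w‖ ≤ 1 → (‖z‖ < 1 ∨ ‖z‖ = 1 ∧ ‖w‖ = 1) → ev z w p ≠ 0 :=
    fun hn hw h => hc.ev_ne_zero_of_left hn hK hp hw h
  have hr : ∀ {z w : ℂ}, 0 < m → ‖z‖ ≤ 1 → (‖w‖ < 1 ∨ ‖w‖ = 1 ∧ ‖z‖ = 1) → ev z w p ≠ 0 := by
    intro z w hm hz h
    rw [← ev_swapT]
    exact hc.swap.ev_ne_zero_of_left hm (hK.swap hc) hp.swap hz h
  -- If a degree is zero, `p` does not depend on that variable, which may be moved to `1` so that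
  -- the other half of the argument applies.
  rcases Nat.eq_zero_or_pos n with rfl | hn
  · have e : ∀ z w, ev z w p = ev 1 w p := fun z w => by
      rw [ev_eq_sum hp.mem, ev_eq_sum hp.mem]; simp
    rw [e]
    rcases Nat.eq_zero_or_pos m with rfl | hm
    · rw [ev_eq_sum hp.mem]
      have h00 : p ((0 : ℤ), (0 : ℤ)) ≠ 0 := fun h =>
        left_ne_zero_of_mul_eq_one hp.pair_one (by rw [show p 0 = 0 from h, map_zero])
      simpa using h00
    · exact hr hm (by simp) (by simpa using hw.lt_or_eq)
  · rcases Nat.eq_zero_or_pos m with rfl | hm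
    · have e : ev z w p = ev z 1 p := by
        rw [ev_eq_sum hp.mem, ev_eq_sum hp.mem]; simp
      rw [e]
      exact hl hn (by simp) (by simpa using hz.lt_or_eq)
    · rcases hz.lt_or_eq with h1 | h1
      · exact hl hn hw (Or.inl h1)
      · rcases hw.lt_or_eq with h2 | h2
        · exact hr hm hz (Or.inl h2)
        · exact hl hn hw (Or.inr ⟨h1, h2⟩)
end Bicircle

/-! ### Orthogonality in a quarter plane: the Hilbert space argument. -/

namespace Bicircle

open Finset MeasureTheory
open scoped ComplexConjugate ENNReal InnerProductSpace

section Hilbert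

variable {H : Type*} [NormedAddCommGroup H] [InnerProductSpace ℂ H]

lemma inner_eq_zero_of_coeff {ι : Type*} (b : HilbertBasis ι ℂ H) {x y : H}
    (h : ∀ s, ⟪b s, x⟫_ℂ = 0 ∨ ⟪b s, y⟫_ℂ = 0) : ⟪x, y⟫_ℂ = 0 := by
  rw [← b.tsum_inner_mul_inner x y]
  refine (tsum_congr fun s => ?_).trans tsum_zero
  rcases h s with h | h
  · rw [← inner_conj_symm, h, map_zero, zero_mul]
  · rw [h, mul_zero]

/-- Let `P` raise exponents by at most `(n, m)`, and let its inverse `Q` raise exponents.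
If `y` has bidegree `≤ (n, m - 1)` and `Q y` is orthogonal to `Q e_s` for `s` in the box
`n × m`, then it is orthogonal to `Q e_s` for all `s` in a quarter plane. -/
theorem inner_eq_zero_of_box [CompleteSpace H] (b : HilbertBasis (ℤ × ℤ) ℂ H) (P Q P' Q' : H →L[ℂ] H)
    (hPQ : ∀ x, P (Q x) = x) (hQP : ∀ x, Q (P x) = x) (hPQ' : ∀ x, P' (Q' x) = x)
    (hcomm : ∀ x, P (Q' x) = Q' (P x)) (hP' : ∀ x y, ⟪P' x, y⟫_ℂ = ⟪x, P y⟫_ℂ)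
    (hQ' : ∀ x y, ⟪Q' x, y⟫_ℂ = ⟪x, Q y⟫_ℂ) {n m : ℕ}
    (hPs : ∀ s t, ⟪b t, P (b s)⟫_ℂ ≠ 0 → s ≤ t ∧ t ≤ s + ((n : ℤ), (m : ℤ)))
    (hQs : ∀ s t, ⟪b t, Q (b s)⟫_ℂ ≠ 0 → s ≤ t) {y : H}
    (hy : ∀ s ∉ boxSet (n + 1) m, ⟪b s, y⟫_ℂ = 0)
    (hort : ∀ s ∈ boxSet n m, ⟪Q (b s), Q y⟫_ℂ = 0) (s : ℤ × ℤ) (hs1 : s.1 < n) (hs2 : 0 ≤ s.2) :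
    ⟪Q (b s), Q y⟫_ℂ = 0 := by
  -- The next four facts bound the frequencies of an image: `P` and `Q` move them up, the adjoints
  -- `P'` and `Q'` down, and `P`, `P'` by at most `(n, m)`.
  have cP : ∀ t u, (∀ s, s ≤ t → t ≤ s + ((n : ℤ), (m : ℤ)) → ⟪b s, u⟫_ℂ = 0) →
      ⟪b t, P u⟫_ℂ = 0 := by
    intro t u h
    rw [← hP']
    refine inner_eq_zero_of_coeff b fun s => ?_
    by_cases h0 : ⟪b t, P (b s)⟫_ℂ = 0
    · left; rw [← inner_conj_symm, hP', h0, map_zero]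
    · right; exact h s (hPs s t h0).1 (hPs s t h0).2
  have cQ : ∀ t u, (∀ s, s ≤ t → ⟪b s, u⟫_ℂ = 0) → ⟪b t, Q u⟫_ℂ = 0 := by
    intro t u h
    rw [← hQ']
    refine inner_eq_zero_of_coeff b fun s => ?_
    by_cases h0 : ⟪b t, Q (b s)⟫_ℂ = 0
    · left; rw [← inner_conj_symm, hQ', h0, map_zero]
    · right; exact h s (hQs s t h0)
  have cP' : ∀ t u, (∀ s, t ≤ s → s ≤ t + ((n : ℤ), (m : ℤ)) → ⟪b s, u⟫_ℂ = 0) →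
      ⟪b t, P' u⟫_ℂ = 0 := by
    intro t u h
    rw [← inner_conj_symm, hP', inner_conj_symm]
    refine inner_eq_zero_of_coeff b fun s => ?_
    by_cases h0 : ⟪b s, P (b t)⟫_ℂ = 0
    · left; exact h0
    · right; exact h s (hPs t s h0).1 (hPs t s h0).2
  have cQ' : ∀ t u, (∀ s, t ≤ s → ⟪b s, u⟫_ℂ = 0) → ⟪b t, Q' u⟫_ℂ = 0 := by
    intro t u h
    rw [← inner_conj_symm, hQ', inner_conj_symm]
    refine inner_eq_zero_of_coeff b fun s => ?_
    by_cases h0 : ⟪b s, Q (b t)⟫_ℂ = 0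
    · left; exact h0
    · right; exact h s (hQs t s h0)
  -- `B` consists of the vectors whose image under `P` has frequencies with first component `< n`
  -- and second component `≥ 0`. It contains every `Q e_s` of the conclusion, so it suffices that `Q
  -- y` is orthogonal to `B`, that is, that its projection `g` vanishes.
  set B : Submodule ℂ H := ⨅ t : {t : ℤ × ℤ // ¬ (t.1 < n ∧ 0 ≤ t.2)},
    LinearMap.ker ((innerSL ℂ (b t.1)).comp P).toLinearMap with hB
  have memB : ∀ x, x ∈ B ↔ ∀ t : ℤ × ℤ, ¬ (t.1 < n ∧ 0 ≤ t.2) → ⟪b t, P x⟫_ℂ = 0 := by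
    intro x
    simp [hB, Submodule.mem_iInf]
  have hBc : IsClosed (B : Set H) := by
    rw [hB, Submodule.coe_iInf]
    exact isClosed_iInter fun t => ContinuousLinearMap.isClosed_ker _
  have : CompleteSpace B := hBc.completeSpace_coe
  obtain ⟨g, hg, e, he, hge⟩ := B.exists_add_mem_mem_orthogonal (Q y)
  have hgB := (memB g).1 hg
  have horth0 : ∀ i j, i ≠ j → ⟪b i, b j⟫_ℂ = 0 := fun i j h => b.orthonormal.2 h
  have hQB : ∀ s : ℤ × ℤ, s.1 < n → 0 ≤ s.2 → Q (b s) ∈ B := by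
    intro s h1 h2
    rw [memB]
    intro t ht
    rw [hPQ]
    exact horth0 t s (by rintro rfl; exact ht ⟨h1, h2⟩)
  have hQe : ∀ s : ℤ × ℤ, s.1 < n → 0 ≤ s.2 → ⟪b s, Q' e⟫_ℂ = 0 := by
    intro s h1 h2
    rw [← inner_conj_symm, hQ', inner_conj_symm]
    exact (Submodule.mem_orthogonal B e).1 he _ (hQB s h1 h2)
  have hPe : P e = y - P g := by
    rw [← hPQ y, hge, map_add]; abel
  have e1 : ∀ s : ℤ × ℤ, ¬ (s.1 < n + 1 ∧ 0 ≤ s.2) → ⟪b s, P e⟫_ℂ = 0 := by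
    intro s h
    rw [hPe, inner_sub_right, hy, hgB, sub_zero]
    · omega
    · rw [mem_boxSet]; push_cast; omega
  -- The left half is excluded by `e = P' Q' e` and the orthogonality of `e` to `B`; the lower half
  -- by `e = Q P e`.
  have e2 : ∀ s : ℤ × ℤ, ¬ (0 ≤ s.1 ∧ 0 ≤ s.2) → ⟪b s, e⟫_ℂ = 0 := by
    intro s h
    by_cases h2 : 0 ≤ s.2
    · have h1 : s.1 < 0 := by omega
      rw [← hPQ' e]
      refine cP' _ _ fun t ht1 ht2 => hQe t ?_ ?_
      · have := ht2.1; simp at this; omega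
      · exact h2.trans ht1.2
    · rw [← hQP e]
      refine cQ _ _ fun t ht => e1 t ?_
      have := ht.2
      omega
  have e3 : ∀ s : ℤ × ℤ, ¬ (0 ≤ s.1) → ⟪b s, P e⟫_ℂ = 0 := by
    intro s h
    refine cP _ _ fun t ht _ => e2 t ?_
    have := ht.1
    omega
  -- For `s.1 < n` the operators are commuted and `Q' e` has no frequencies to contribute; for `s.1
  -- ≥ n` only frequencies above `s` matter, and neither `y` nor `P g` has any.
  have e4 : ∀ s : ℤ × ℤ, (m : ℤ) ≤ s.2 → ⟪b s, Q' (P e)⟫_ℂ = 0 := by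
    intro s h
    by_cases h1 : s.1 < n
    · rw [← hcomm]
      refine cP _ _ fun t ht1 ht2 => hQe t ?_ ?_
      · have := ht1.1; omega
      · have := ht2.2; simp at this; omega
    · rw [hPe]
      refine cQ' _ _ fun t ht => ?_
      have t1 := ht.1
      have t2 := ht.2
      rw [inner_sub_right, hy, hgB, sub_zero]
      · omega
      · rw [mem_boxSet]; push_cast; omega
  have e5 : ∀ s : ℤ × ℤ, (m : ℤ) ≤ s.2 → ⟪b s, P e⟫_ℂ = 0 := by
    intro s h
    rw [← hPQ' (P e)]
    exact cP' _ _ fun t ht _ => e4 t (h.trans ht.2)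
  have hPg : P g = y - P e := by rw [hPe]; abel
  -- So `P g` is a polynomial in the small box, to which the hypothesis on `Q y` applies.
  have g1 : ∀ s ∉ boxSet n m, ⟪b s, P g⟫_ℂ = 0 := by
    intro s hs
    by_cases h : s.1 < n ∧ 0 ≤ s.2
    · rw [hPg, inner_sub_right, hy]
      · rw [zero_sub, neg_eq_zero]
        rw [mem_boxSet] at hs
        by_cases h1 : 0 ≤ s.1
        · exact e5 s (by omega)
        · exact e3 s h1
      · rw [mem_boxSet] at *; push_cast; omega
    · exact hgB s h
  have gy : ⟪g, Q y⟫_ℂ = 0 := by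
    rw [← hQP g, ← inner_conj_symm, ← hQ', inner_conj_symm]
    refine inner_eq_zero_of_coeff b fun s => ?_
    by_cases hs : s ∈ boxSet n m
    · right
      rw [← inner_conj_symm, hQ', inner_conj_symm, hort s hs]
    · left; exact g1 s hs
  -- Since `Q y = g + e` with `e` orthogonal to `g`, the product of `g` with `Q y` is `‖g‖²`.
  have gg : g = 0 := by
    rw [hge, inner_add_right, (Submodule.mem_orthogonal B e).1 he g hg, add_zero] at gy
    exact inner_self_eq_zero.1 gy
  rw [hge, gg, zero_add]
  exact (Submodule.mem_orthogonal B e).1 he _ (hQB s hs1 hs2)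

end Hilbert

end Bicircle

/-! ### Integration over the torus and moments of a density. -/

namespace Bicircle

open Finset MeasureTheory
open scoped ComplexConjugate ENNReal InnerProductSpace

instance twoPiPos : Fact (0 < 2 * Real.pi) := ⟨Real.two_pi_pos⟩

/-- The circle, as the additive group of angles. -/
abbrev Ang := AddCircle (2 * Real.pi)

/-- The point of the unit circle with a given angle. -/
noncomputable def U (t : Ang) : ℂ := (AddCircle.toCircle t : ℂ)

lemma U_coe (x : ℝ) : U (x : Ang) = Complex.exp (x * Complex.I) := by
  rw [U, AddCircle.toCircle_apply_mk, Circle.coe_exp, div_self Real.two_pi_pos.ne', one_mul]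

@[simp] lemma norm_U (t : Ang) : ‖U t‖ = 1 := Circle.norm_coe _

lemma U_ne_zero (t : Ang) : U t ≠ 0 := Circle.coe_ne_zero _

lemma conj_U (t : Ang) : conj (U t) = (U t)⁻¹ := (Complex.inv_eq_conj (norm_U t)).symm

@[fun_prop] lemma continuous_U : Continuous U :=
  continuous_subtype_val.comp AddCircle.continuous_toCircle

lemma U_injective : Function.Injective U := fun _ _ h =>
  AddCircle.injective_toCircle Real.two_pi_pos.ne' (Subtype.ext h)

lemma exists_U_eq {z : ℂ} (hz : ‖z‖ = 1) : ∃ t, U t = z := by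
  refine ⟨(z.arg : Ang), ?_⟩
  rw [U_coe]
  conv_rhs => rw [← Complex.norm_mul_exp_arg_mul_I z, hz]
  simp

/-- The normalized measure on the circle. -/
noncomputable abbrev μ₁ : Measure Ang := AddCircle.haarAddCircle

/-- The normalized measure on the torus. -/
noncomputable abbrev μ₂ : Measure (Ang × Ang) := μ₁.prod μ₁

lemma integrable_one {F : Ang → ℂ} (hF : Continuous F) : Integrable F μ₁ :=
  hF.integrable_of_hasCompactSupport (HasCompactSupport.of_compactSpace _)

lemma integrable_two {F : Ang × Ang → ℂ} (hF : Continuous F) : Integrable F μ₂ :=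
  hF.integrable_of_hasCompactSupport (HasCompactSupport.of_compactSpace _)

lemma integral_ang (F : ℂ → ℂ) (a : ℝ) : ∫ t, F (U t) ∂μ₁ =
    ((2 * Real.pi : ℝ) : ℂ)⁻¹ * ∫ x in a..(a + 2 * Real.pi), F (Complex.exp (x * Complex.I)) := by
  rw [AddCircle.integral_haarAddCircle, ← AddCircle.intervalIntegral_preimage _ a,
    Complex.real_smul, Complex.ofReal_inv]
  simp only [U_coe]

lemma integral_eq_circleAverage (F : ℂ → ℂ) :
    ∫ t, F (U t) ∂μ₁ = Real.circleAverage F 0 1 := by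
  rw [integral_ang F 0, Real.circleAverage_def, Complex.real_smul, Complex.ofReal_inv, zero_add]
  simp [circleMap_zero]

lemma integral_analytic {F : ℂ → ℂ} (hF : DiffContOnCl ℂ F (Metric.ball 0 1)) :
    ∫ t, F (U t) ∂μ₁ = F 0 := by
  rw [integral_eq_circleAverage]
  exact DiffContOnCl.circleAverage (by simpa using hF)

lemma integral_cauchy {F : ℂ → ℂ} (hF : DiffContOnCl ℂ F (Metric.ball 0 1)) {z : ℂ}
    (hz : ‖z‖ < 1) : ∫ t, U t / (U t - z) * F (U t) ∂μ₁ = F z := by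
  rw [integral_eq_circleAverage (fun u => u / (u - z) * F u)]
  have := DiffContOnCl.circleAverage_smul_div (c := 0) (R := 1) (w := z) (by simpa using hF)
    (by simpa using hz)
  simpa using this

/-- Integration over the torus. -/
noncomputable def tint (F : ℂ → ℂ → ℂ) : ℂ := ∫ t, F (U t.1) (U t.2) ∂μ₂

/-- Continuity of a function on the torus. -/
def ContT (F : ℂ → ℂ → ℂ) : Prop := Continuous fun t : Ang × Ang => F (U t.1) (U t.2)

lemma ContT.integrable {F : ℂ → ℂ → ℂ} (hF : ContT F) :
    Integrable (fun t : Ang × Ang => F (U t.1) (U t.2)) μ₂ := integrable_two hF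

lemma tint_eq (F : ℂ → ℂ → ℂ) (hF : ContT F) :
    tint F = ∫ s, ∫ t, F (U s) (U t) ∂μ₁ ∂μ₁ := integral_prod _ hF.integrable

lemma tint_eq_symm (F : ℂ → ℂ → ℂ) (hF : ContT F) :
    tint F = ∫ t, ∫ s, F (U s) (U t) ∂μ₁ ∂μ₁ := integral_prod_symm _ hF.integrable

lemma tint_swap (F : ℂ → ℂ → ℂ) : tint (fun z w => F w z) = tint F :=
  integral_prod_swap (μ := μ₁) (ν := μ₁) (fun t : Ang × Ang => F (U t.1) (U t.2))

lemma tint_congr {F G : ℂ → ℂ → ℂ} (h : ∀ z w, ‖z‖ = 1 → ‖w‖ = 1 → F z w = G z w) :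
    tint F = tint G := by
  unfold tint
  congr 1; funext t
  exact h _ _ (norm_U _) (norm_U _)

lemma functional_eq_tint (f g : ℂ → ℂ → ℂ) (h : ContT fun z w => g z w / f z w) :
    functional f g = tint fun z w => g z w / f z w := by
  rw [tint_eq _ h, functional]
  have e : ∀ G : ℂ → ℂ, ∫ t, G (U t) ∂μ₁ = (2 * (Real.pi : ℂ))⁻¹ *
      ∫ x in (-Real.pi)..Real.pi, G (Complex.exp (x * Complex.I)) := by
    intro G
    rw [integral_ang G (-Real.pi)]
    congr 2
    · push_cast; ring
    · ring
  rw [e (fun u => ∫ t, g u (U t) / f u (U t) ∂μ₁)]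
  have e' : ∀ u : ℂ, ∫ t, g u (U t) / f u (U t) ∂μ₁ = (2 * (Real.pi : ℂ))⁻¹ *
      ∫ x in (-Real.pi)..Real.pi, g u (Complex.exp (x * Complex.I)) /
        f u (Complex.exp (x * Complex.I)) := fun u => e (fun v => g u v / f u v)
  simp only [e', intervalIntegral.integral_const_mul]
  ring

lemma ContT.mul {F G : ℂ → ℂ → ℂ} (hF : ContT F) (hG : ContT G) :
    ContT fun z w => F z w * G z w := Continuous.mul hF hG

lemma ContT.add {F G : ℂ → ℂ → ℂ} (hF : ContT F) (hG : ContT G) :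
    ContT fun z w => F z w + G z w := Continuous.add hF hG

lemma ContT.sub {F G : ℂ → ℂ → ℂ} (hF : ContT F) (hG : ContT G) :
    ContT fun z w => F z w - G z w := Continuous.sub hF hG

lemma ContT.conj {F : ℂ → ℂ → ℂ} (hF : ContT F) :
    ContT fun z w => (starRingEnd ℂ) (F z w) := Complex.continuous_conj.comp hF

lemma ContT.inv {F : ℂ → ℂ → ℂ} (hF : ContT F) (h : ∀ z w, ‖z‖ = 1 → ‖w‖ = 1 → F z w ≠ 0) :
    ContT fun z w => (F z w)⁻¹ := Continuous.inv₀ hF fun _ => h _ _ (norm_U _) (norm_U _)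

lemma contT_const (c : ℂ) : ContT fun _ _ => c := continuous_const

lemma contT_monomial (s : ℤ × ℤ) : ContT fun z w => z ^ s.1 * w ^ s.2 := by
  unfold ContT
  refine Continuous.mul (Continuous.zpow₀ (by fun_prop) _ fun t => Or.inl (U_ne_zero _))
    (Continuous.zpow₀ (by fun_prop) _ fun t => Or.inl (U_ne_zero _))

lemma contT_ev (x : Trig) : ContT fun z w => ev z w x := by
  induction x using Finsupp.induction_linear with
  | zero => simpa using contT_const 0
  | add x y hx hy => simpa using hx.add hy
  | single s a => simpa [ev_single] using (contT_const a).mul (contT_monomial s)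

lemma tint_add {F G : ℂ → ℂ → ℂ} (hF : ContT F) (hG : ContT G) :
    tint (fun z w => F z w + G z w) = tint F + tint G := integral_add hF.integrable hG.integrable

lemma tint_sub {F G : ℂ → ℂ → ℂ} (hF : ContT F) (hG : ContT G) :
    tint (fun z w => F z w - G z w) = tint F - tint G := integral_sub hF.integrable hG.integrable

lemma tint_const_mul (c : ℂ) (F : ℂ → ℂ → ℂ) : tint (fun z w => c * F z w) = c * tint F :=
  integral_const_mul _ _

lemma tint_conj (F : ℂ → ℂ → ℂ) : tint (fun z w => conj (F z w)) = conj (tint F) :=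
  integral_conj

/-- The measure charges every nonempty open set, so a continuous nonnegative integrand that is
positive somewhere has positive integral. The function `r` is the real form of the integrand on the
torus. -/
lemma eq_zero_of_tint_eq_zero {F : ℂ → ℂ → ℂ} {r : ℂ → ℂ → ℝ} (hF : ContT F)
    (hr : ∀ z w, ‖z‖ = 1 → ‖w‖ = 1 → F z w = r z w ∧ 0 ≤ r z w) (h0 : (tint F).re ≤ 0)
    {z w : ℂ} (hz : ‖z‖ = 1) (hw : ‖w‖ = 1) : r z w = 0 := by
  by_contra hne
  obtain ⟨s, rfl⟩ := exists_U_eq hz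
  obtain ⟨t, rfl⟩ := exists_U_eq hw
  have hcont : Continuous fun t : Ang × Ang => r (U t.1) (U t.2) := by
    have h1 : Continuous fun t : Ang × Ang => (F (U t.1) (U t.2)).re :=
      Complex.continuous_re.comp hF
    convert h1 using 2 with t
    rw [(hr _ _ (norm_U _) (norm_U _)).1, Complex.ofReal_re]
  have hpos := Continuous.integral_pos_of_hasCompactSupport_nonneg_nonzero (μ := μ₂) hcont
    (HasCompactSupport.of_compactSpace _) (fun t => (hr _ _ (norm_U _) (norm_U _)).2)
    (x := (s, t)) hne
  have e : tint F = ((∫ t, r (U t.1) (U t.2) ∂μ₂ : ℝ) : ℂ) := by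
    rw [tint, ← integral_complex_ofReal]
    congr 1; funext t
    exact (hr _ _ (norm_U _) (norm_U _)).1
  rw [e, Complex.ofReal_re] at h0
  linarith

lemma integral_U_pow (k : ℕ) (hk : k ≠ 0) : ∫ t, U t ^ k ∂μ₁ = 0 := by
  rw [integral_analytic (F := fun u => u ^ k) (Differentiable.diffContOnCl (by fun_prop))]
  simp [hk]

lemma integral_U_zpow (k : ℤ) : ∫ t, U t ^ k ∂μ₁ = if k = 0 then 1 else 0 := by
  split_ifs with h
  · simp [h]
  · obtain ⟨n, rfl | rfl⟩ := Int.eq_nat_or_neg k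
    · simpa using integral_U_pow n (by simpa using h)
    · have e : ∀ t : Ang, U t ^ (-(n : ℤ)) = conj (U t ^ n) := fun t => by
        rw [map_pow, conj_U, zpow_neg, zpow_natCast, inv_pow]
      simp only [e]
      rw [integral_conj, integral_U_pow n (by simpa using h), map_zero]

lemma tint_monomial (s : ℤ × ℤ) : tint (fun z w => z ^ s.1 * w ^ s.2) = if s = 0 then 1 else 0 := by
  rw [tint, integral_prod_mul (fun t => U t ^ s.1) (fun t => U t ^ s.2), integral_U_zpow,
    integral_U_zpow]
  by_cases h1 : s.1 = 0 <;> by_cases h2 : s.2 = 0 <;> simp [h1, h2, Prod.ext_iff]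

lemma tint_monomial_mul_ev (s : ℤ × ℤ) (x : Trig) :
    tint (fun z w => z ^ s.1 * w ^ s.2 * ev z w x) = x (-s) := by
  induction x using Finsupp.induction_linear with
  | zero => simp [tint]
  | add x y hx hy =>
    simp only [map_add, mul_add]
    rw [tint_add ((contT_monomial s).mul (contT_ev x)) ((contT_monomial s).mul (contT_ev y)),
      hx, hy, Finsupp.add_apply]
  | single t a =>
    have e : tint (fun z w => z ^ s.1 * w ^ s.2 * ev z w (Finsupp.single t a)) =
        tint (fun z w => a * (z ^ (s + t).1 * w ^ (s + t).2)) := by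
      refine tint_congr fun z w hz hw => ?_
      have hz0 : z ≠ 0 := by rintro rfl; simp at hz
      have hw0 : w ≠ 0 := by rintro rfl; simp at hw
      rw [ev_single, Prod.fst_add, Prod.snd_add, zpow_add₀ hz0, zpow_add₀ hw0]
      ring
    rw [e, tint_const_mul, tint_monomial, Finsupp.single_apply]
    have : s + t = 0 ↔ t = -s := by rw [add_comm, add_eq_zero_iff_eq_neg]
    simp [this]

/-- The moments of the density `ρ`. -/
noncomputable def mom (ρ : ℂ → ℂ → ℂ) (s : ℤ × ℤ) : ℂ :=
  tint fun z w => z ^ s.1 * w ^ s.2 * ρ z w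

lemma mom_swap (ρ : ℂ → ℂ → ℂ) : (fun s => mom ρ s.swap) = mom fun z w => ρ w z := by
  funext s
  rw [mom, mom, ← tint_swap]
  simp only [Prod.fst_swap, Prod.snd_swap, mul_comm]

lemma conj_zpow_of_norm {z : ℂ} (hz : ‖z‖ = 1) (k : ℤ) : conj (z ^ k) = z ^ (-k) := by
  rw [map_zpow₀, ← Complex.inv_eq_conj hz, inv_zpow, zpow_neg]

lemma pair_mom {ρ : ℂ → ℂ → ℂ} (hρ : ContT ρ) (x y : Trig) :
    pair (mom ρ) x y = tint fun z w => ev z w x * conj (ev z w y) * ρ z w := by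
  induction x using Finsupp.induction_linear with
  | zero => simp [tint]
  | add x x' hx hx' =>
    rw [pair_add_left, hx, hx', ← tint_add (((contT_ev x).mul (contT_ev y).conj).mul hρ)
      (((contT_ev x').mul (contT_ev y).conj).mul hρ)]
    simp only [map_add, add_mul]
  | single t a =>
    induction y using Finsupp.induction_linear with
    | zero => simp [tint]
    | add y y' hy hy' =>
      rw [pair_add_right, hy, hy', ← tint_add (((contT_ev _).mul (contT_ev y).conj).mul hρ)
        (((contT_ev _).mul (contT_ev y').conj).mul hρ)]
      simp only [map_add, add_mul, mul_add]
    | single u b =>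
      rw [pair_single, mom, ← tint_const_mul]
      refine tint_congr fun z w hz hw => ?_
      have hz0 : z ≠ 0 := by rintro rfl; simp at hz
      have hw0 : w ≠ 0 := by rintro rfl; simp at hw
      rw [Prod.fst_sub, Prod.snd_sub]
      simp only [ev_single, map_mul, conj_zpow_of_norm hz, conj_zpow_of_norm hw,
        sub_eq_add_neg, zpow_add₀ hz0, zpow_add₀ hw0]
      ring

lemma eq_zero_of_ev {x : Trig} (h : ∀ z w, ‖z‖ = 1 → ‖w‖ = 1 → ev z w x = 0) : x = 0 := by
  ext s
  have := tint_monomial_mul_ev (-s) x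
  rw [neg_neg] at this
  rw [← this, Finsupp.zero_apply]
  have e : tint (fun z w => z ^ (-s).1 * w ^ (-s).2 * ev z w x) = tint (fun _ _ => 0) :=
    tint_congr fun z w hz hw => by rw [h z w hz hw, mul_zero]
  rw [e]
  simp [tint]

lemma isPosDef_mom {ρ : ℂ → ℂ → ℂ} (hρ : ContT ρ) {r : ℂ → ℂ → ℝ}
    (hr : ∀ z w, ‖z‖ = 1 → ‖w‖ = 1 → ρ z w = r z w ∧ 0 < r z w) : IsPosDef (mom ρ) where
  herm s := by
    rw [mom, mom, ← tint_conj]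
    refine tint_congr fun z w hz hw => ?_
    simp only [map_mul, conj_zpow_of_norm hz, conj_zpow_of_norm hw, Prod.fst_neg, Prod.snd_neg,
      (hr z w hz hw).1, Complex.conj_ofReal]
  pos x hx := by
    by_contra! hle
    apply hx
    rw [pair_mom hρ] at hle
    refine eq_zero_of_ev fun z w hz hw => ?_
    have := eq_zero_of_tint_eq_zero (r := fun z w => ‖ev z w x‖ ^ 2 * r z w)
      (((contT_ev x).mul (contT_ev x).conj).mul hρ) (fun z w hz hw => ⟨by
        rw [(hr z w hz hw).1, Complex.mul_conj']; push_cast; ring, by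
        have := (hr z w hz hw).2; positivity⟩) hle hz hw
    have h2 := (mul_eq_zero.1 this).resolve_right (hr z w hz hw).2.ne'
    simpa using h2

end Bicircle

/-! ### The space `L²` of the torus, and necessity of the splitting condition. -/

namespace Bicircle

open Finset MeasureTheory
open scoped ComplexConjugate ENNReal InnerProductSpace

/-- The monomials as continuous functions on the torus. -/
noncomputable def monC (s : ℤ × ℤ) : C(Ang × Ang, ℂ) :=
  ⟨fun t => U t.1 ^ s.1 * U t.2 ^ s.2, contT_monomial s⟩

@[simp] lemma monC_apply (s : ℤ × ℤ) (t : Ang × Ang) :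
    monC s t = U t.1 ^ s.1 * U t.2 ^ s.2 := rfl

lemma monC_add (s t : ℤ × ℤ) : monC (s + t) = monC s * monC t := by
  ext u
  simp only [monC_apply, ContinuousMap.mul_apply, Prod.fst_add, Prod.snd_add,
    zpow_add₀ (U_ne_zero _)]
  ring

lemma star_monC (s : ℤ × ℤ) : star (monC s) = monC (-s) := by
  ext u
  simp only [monC_apply, ContinuousMap.star_apply, RCLike.star_def, map_mul,
    conj_zpow_of_norm (norm_U _), Prod.fst_neg, Prod.snd_neg]

lemma monC_zero : monC 0 = 1 := by
  ext u; simp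

/-- The trigonometric polynomials as a subalgebra of the continuous functions on the torus. -/
noncomputable def monSubalgebra : StarSubalgebra ℂ C(Ang × Ang, ℂ) where
  toSubalgebra := Algebra.adjoin ℂ (Set.range monC)
  star_mem' := by
    change Algebra.adjoin ℂ (Set.range monC) ≤ star (Algebra.adjoin ℂ (Set.range monC))
    refine Algebra.adjoin_le ?_
    rintro _ ⟨s, rfl⟩
    exact Algebra.subset_adjoin ⟨-s, (star_monC s).symm⟩

lemma monSubalgebra_coe :
    Subalgebra.toSubmodule monSubalgebra.toSubalgebra = Submodule.span ℂ (Set.range monC) := by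
  apply Algebra.adjoin_eq_span_of_subset
  refine .trans (fun x ↦ Submonoid.closure_induction (fun _ ↦ id) ⟨0, ?_⟩ ?_)
    Submodule.subset_span
  · exact monC_zero
  · rintro _ _ _ _ ⟨s, rfl⟩ ⟨t, rfl⟩
    exact ⟨s + t, monC_add s t⟩

lemma monSubalgebra_separatesPoints : monSubalgebra.SeparatesPoints := by
  intro x y hxy
  have : x.1 ≠ y.1 ∨ x.2 ≠ y.2 := by
    by_contra! h
    exact hxy (Prod.ext h.1 h.2)
  rcases this with h | h
  · refine ⟨_, ⟨monC (1, 0), Algebra.subset_adjoin ⟨(1, 0), rfl⟩, rfl⟩, fun h' => h ?_⟩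
    exact U_injective (by simpa using h')
  · refine ⟨_, ⟨monC (0, 1), Algebra.subset_adjoin ⟨(0, 1), rfl⟩, rfl⟩, fun h' => h ?_⟩
    exact U_injective (by simpa using h')

lemma span_monC_closure_eq_top :
    (Submodule.span ℂ (Set.range monC)).topologicalClosure = ⊤ := by
  rw [← monSubalgebra_coe]
  exact congr_arg (Subalgebra.toSubmodule <| StarSubalgebra.toSubalgebra ·)
    (ContinuousMap.starSubalgebra_topologicalClosure_eq_top_of_separatesPoints _
      monSubalgebra_separatesPoints)

/-- The square integrable functions on the torus. -/
noncomputable abbrev L2T := Lp ℂ 2 μ₂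

/-- A continuous function as an element of `L2T`. -/
noncomputable abbrev toL2 : C(Ang × Ang, ℂ) →L[ℂ] L2T := ContinuousMap.toLp 2 μ₂ ℂ

/-- A function which is continuous on the torus as an element of `C(Ang × Ang, ℂ)`. -/
noncomputable def ContT.toC {F : ℂ → ℂ → ℂ} (hF : ContT F) : C(Ang × Ang, ℂ) :=
  ⟨fun t => F (U t.1) (U t.2), hF⟩

lemma toC_apply {F : ℂ → ℂ → ℂ} (hF : ContT F) (t : Ang × Ang) :
    hF.toC t = F (U t.1) (U t.2) := rfl

lemma inner_toL2 {F G : ℂ → ℂ → ℂ} (hF : ContT F) (hG : ContT G) :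
    ⟪toL2 hF.toC, toL2 hG.toC⟫_ℂ = tint fun z w => G z w * conj (F z w) :=
  ContinuousMap.inner_toLp μ₂ hF.toC hG.toC

lemma orthonormal_monC : Orthonormal ℂ fun s => toL2 (monC s) := by
  rw [orthonormal_iff_ite]
  intro s t
  refine (inner_toL2 (contT_monomial s) (contT_monomial t)).trans ?_
  have : tint (fun z w => z ^ t.1 * w ^ t.2 * conj (z ^ s.1 * w ^ s.2)) =
      tint fun z w => z ^ (t - s).1 * w ^ (t - s).2 := by
    refine tint_congr fun z w hz hw => ?_
    have hz0 : z ≠ 0 := by rintro rfl; simp at hz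
    have hw0 : w ≠ 0 := by rintro rfl; simp at hw
    rw [Prod.fst_sub, Prod.snd_sub]
    simp only [map_mul, conj_zpow_of_norm hz, conj_zpow_of_norm hw, sub_eq_add_neg,
      zpow_add₀ hz0, zpow_add₀ hw0]
    ring
  rw [this, tint_monomial]
  simp only [sub_eq_zero, eq_comm]

/-- The monomials form a Hilbert basis of `L2T`. -/
noncomputable def monBasis : HilbertBasis (ℤ × ℤ) ℂ L2T :=
  HilbertBasis.mk orthonormal_monC (by
    have h := (ContinuousMap.toLp_denseRange ℂ μ₂ ℂ (p := 2)
      (by simp)).topologicalClosure_map_submodule span_monC_closure_eq_top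
    rw [Submodule.map_span, ← Set.range_comp] at h
    exact h.ge)

lemma monBasis_apply (s : ℤ × ℤ) : monBasis s = toL2 (monC s) := by
  rw [monBasis, HilbertBasis.coe_mk]

/-- Multiplication by a continuous function as an operator on `L2T`. -/
noncomputable def mulOp (g : C(Ang × Ang, ℂ)) : L2T →L[ℂ] L2T :=
  (ContinuousLinearMap.mul ℂ ℂ).holderL μ₂ ∞ 2 2 (ContinuousMap.toLp ∞ μ₂ ℂ g)

lemma coeFn_mulOp (g : C(Ang × Ang, ℂ)) (f : L2T) : mulOp g f =ᵐ[μ₂] fun t => g t * f t := by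
  have h1 := (ContinuousLinearMap.mul ℂ ℂ).coeFn_holder (r := 2) (ContinuousMap.toLp ∞ μ₂ ℂ g) f
  have h2 := ContinuousMap.coeFn_toLp (p := ∞) (𝕜 := ℂ) μ₂ g
  filter_upwards [h1, h2] with t h1 h2
  rw [← h2]
  exact h1

lemma mulOp_mulOp (g h : C(Ang × Ang, ℂ)) (f : L2T) : mulOp g (mulOp h f) = mulOp (g * h) f := by
  apply Lp.ext
  filter_upwards [coeFn_mulOp g (mulOp h f), coeFn_mulOp h f, coeFn_mulOp (g * h) f]
    with t h1 h2 h3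
  rw [h1, h2, h3, ContinuousMap.mul_apply, mul_assoc]

lemma mulOp_one (f : L2T) : mulOp 1 f = f := by
  apply Lp.ext
  filter_upwards [coeFn_mulOp 1 f] with t h1
  rw [h1, ContinuousMap.one_apply, one_mul]

lemma mulOp_toL2 (g h : C(Ang × Ang, ℂ)) : mulOp g (toL2 h) = toL2 (g * h) := by
  apply Lp.ext
  filter_upwards [coeFn_mulOp g (toL2 h), ContinuousMap.coeFn_toLp (p := 2) (𝕜 := ℂ) μ₂ h,
    ContinuousMap.coeFn_toLp (p := 2) (𝕜 := ℂ) μ₂ (g * h)] with t h1 h2 h3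
  rw [h1, h2, h3, ContinuousMap.mul_apply]

lemma inner_mulOp_star (g : C(Ang × Ang, ℂ)) (x y : L2T) :
    ⟪mulOp (star g) x, y⟫_ℂ = ⟪x, mulOp g y⟫_ℂ := by
  rw [L2.inner_def, L2.inner_def]
  refine integral_congr_ae ?_
  filter_upwards [coeFn_mulOp (star g) x, coeFn_mulOp g y] with t h1 h2
  rw [h1, h2]
  simp only [RCLike.inner_apply, ContinuousMap.star_apply, RCLike.star_def, map_mul,
    Complex.conj_conj]
  ring

lemma differentiable_ev_left {a b : ℕ} {x : Trig} (hx : x ∈ box a b) (w : ℂ) :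
    Differentiable ℂ fun z => ev z w x := by
  have : (fun z => ev z w x) = fun z => ∑ i : Fin a, ∑ j : Fin b,
      x ((i : ℕ), (j : ℕ)) * (z ^ (i : ℕ) * w ^ (j : ℕ)) := funext fun z => ev_eq_sum hx z w
  rw [this]
  fun_prop

lemma differentiable_ev_right {a b : ℕ} {x : Trig} (hx : x ∈ box a b) (z : ℂ) :
    Differentiable ℂ fun w => ev z w x := by
  have : (fun w => ev z w x) = fun w => ∑ i : Fin a, ∑ j : Fin b,
      x ((i : ℕ), (j : ℕ)) * (z ^ (i : ℕ) * w ^ (j : ℕ)) := funext fun w => ev_eq_sum hx z w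
  rw [this]
  fun_prop

/-- `p` has no zeros in the closed bidisk. -/
def Stable (p : Trig) : Prop := ∀ z w : ℂ, ‖z‖ ≤ 1 → ‖w‖ ≤ 1 → ev z w p ≠ 0

lemma Stable.diffContOnCl_left {a b : ℕ} {p : Trig} (hp : Stable p) (hm : p ∈ box a b) {w : ℂ}
    (hw : ‖w‖ ≤ 1) : DiffContOnCl ℂ (fun z => (ev z w p)⁻¹) (Metric.ball 0 1) :=
  (differentiable_ev_left hm w).diffContOnCl.inv fun z hz => hp z w (by
    rw [closure_ball _ one_ne_zero] at hz; simpa using hz) hw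

lemma Stable.diffContOnCl_right {a b : ℕ} {p : Trig} (hp : Stable p) (hm : p ∈ box a b) {z : ℂ}
    (hz : ‖z‖ ≤ 1) : DiffContOnCl ℂ (fun w => (ev z w p)⁻¹) (Metric.ball 0 1) :=
  (differentiable_ev_right hm z).diffContOnCl.inv fun w hw => hp z w hz (by
    rw [closure_ball _ one_ne_zero] at hw; simpa using hw)

lemma Stable.contT_inv {p : Trig} (hp : Stable p) : ContT fun z w => (ev z w p)⁻¹ :=
  (contT_ev p).inv fun z w hz hw => hp z w hz.le hw.le

lemma integral_pow_mul_analytic {F : ℂ → ℂ} (hF : DiffContOnCl ℂ F (Metric.ball 0 1)) {k : ℤ}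
    (hk : 0 < k) : ∫ t, U t ^ k * F (U t) ∂μ₁ = 0 := by
  obtain ⟨n, rfl⟩ := Int.eq_ofNat_of_zero_le hk.le
  simp only [zpow_natCast]
  have hd : DiffContOnCl ℂ (fun u => u ^ n * F u) (Metric.ball 0 1) :=
    DiffContOnCl.smul (Differentiable.diffContOnCl (differentiable_pow n)) hF
  rw [integral_analytic hd]
  have : n ≠ 0 := by rintro rfl; simp at hk
  simp [this]

/-- On a slice where the other variable is fixed on the circle, the integrand is analytic in the
disc and vanishes at the origin, so its mean is zero. Consequently all frequencies of `1/p` are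
nonnegative in both components. -/
lemma Stable.tint_eq_zero {a b : ℕ} {p : Trig} (hp : Stable p) (hm : p ∈ box a b) {s : ℤ × ℤ}
    (hs : 0 < s.1 ∨ 0 < s.2) : tint (fun z w => z ^ s.1 * w ^ s.2 * (ev z w p)⁻¹) = 0 := by
  have hc := (contT_monomial s).mul hp.contT_inv
  rcases hs with hs | hs
  · rw [tint_eq_symm _ hc]
    refine (integral_congr_ae (.of_forall fun t => ?_)).trans (integral_zero _ _)
    have h := integral_pow_mul_analytic (hp.diffContOnCl_left hm (norm_U t).le) hs
    have e : ∀ s' : Ang, U s' ^ s.1 * U t ^ s.2 * (ev (U s') (U t) p)⁻¹ =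
      U t ^ s.2 * (U s' ^ s.1 * (ev (U s') (U t) p)⁻¹) := fun s' => by ring
    simp only [e]
    rw [integral_const_mul, h, mul_zero]
  · rw [tint_eq _ hc]
    refine (integral_congr_ae (.of_forall fun t => ?_)).trans (integral_zero _ _)
    have h := integral_pow_mul_analytic (hp.diffContOnCl_right hm (norm_U t).le) hs
    simp only [mul_assoc]
    rw [integral_const_mul, h, mul_zero]

/-- The density `1 / |p|²`. -/
noncomputable def dens (p : Trig) (z w : ℂ) : ℂ := (ev z w p * conj (ev z w p))⁻¹

lemma Stable.contT_dens {p : Trig} (hp : Stable p) : ContT (dens p) :=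
  ((contT_ev p).mul (contT_ev p).conj).inv fun z w hz hw =>
    mul_ne_zero (hp z w hz.le hw.le) (by simpa using hp z w hz.le hw.le)

lemma Stable.isPosDef {p : Trig} (hp : Stable p) : IsPosDef (mom (dens p)) :=
  isPosDef_mom hp.contT_dens (r := fun z w => (‖ev z w p‖ ^ 2)⁻¹) fun z w hz hw => ⟨by
    rw [dens, Complex.mul_conj']; push_cast; rfl, by
    have := hp z w hz.le hw.le; positivity⟩

/-- The form with density `1 / |p|²` for a stable `p` satisfies the splitting condition. -/
theorem Stable.splitOrth {n m : ℕ} {p : Trig} (hp : Stable p) (hm : p ∈ box (n + 1) (m + 1)) :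
    SplitOrth (mom (dens p)) n m := by
  intro x hx y hy hxv _
  set P := (contT_ev p).toC
  set Q := hp.contT_inv.toC
  have hPQ : P * Q = 1 := by
    ext t
    exact mul_inv_cancel₀ (hp _ _ (norm_U _).le (norm_U _).le)
  have hQP : Q * P = 1 := (mul_comm Q P).trans hPQ
  -- Division by `p` turns the weighted form into the inner product of `L²`.
  have hinner : ∀ u v : Trig, ⟪mulOp Q (toL2 (contT_ev u).toC), mulOp Q (toL2 (contT_ev v).toC)⟫_ℂ =
      pair (mom (dens p)) v u := by
    intro u v
    rw [mulOp_toL2, mulOp_toL2, pair_mom hp.contT_dens]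
    refine (inner_toL2 (hp.contT_inv.mul (contT_ev u)) (hp.contT_inv.mul (contT_ev v))).trans ?_
    refine tint_congr fun z w _ _ => ?_
    simp only [dens, map_mul, map_inv₀, mul_inv]; ring
  have hmon : ∀ s, monBasis s = toL2 (contT_ev (Finsupp.single s 1)).toC := by
    intro s
    rw [monBasis_apply]
    congr 1
    ext t
    simp [toC_apply, ev_single]
  have hcoef : ∀ (s t : ℤ × ℤ) (F : ℂ → ℂ → ℂ) (hF : ContT F),
      ⟪monBasis t, mulOp hF.toC (monBasis s)⟫_ℂ =
        tint fun z w => z ^ (s - t).1 * w ^ (s - t).2 * F z w := by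
    intro s t F hF
    rw [monBasis_apply, monBasis_apply, mulOp_toL2]
    refine (inner_toL2 (contT_monomial t) (hF.mul (contT_monomial s))).trans ?_
    refine tint_congr fun z w hz hw => ?_
    have hz0 : z ≠ 0 := by rintro rfl; simp at hz
    have hw0 : w ≠ 0 := by rintro rfl; simp at hw
    rw [Prod.fst_sub, Prod.snd_sub]
    simp only [map_mul, conj_zpow_of_norm hz, conj_zpow_of_norm hw, sub_eq_add_neg,
      zpow_add₀ hz0, zpow_add₀ hw0]
    ring
  have key := inner_eq_zero_of_box monBasis (mulOp P) (mulOp Q) (mulOp (star P)) (mulOp (star Q))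
    (fun f => by rw [mulOp_mulOp, hPQ, mulOp_one]) (fun f => by rw [mulOp_mulOp, hQP, mulOp_one])
    (fun f => by rw [mulOp_mulOp, ← star_mul', hPQ, star_one, mulOp_one])
    (fun f => by rw [mulOp_mulOp, mulOp_mulOp, mul_comm (star Q) P]) (inner_mulOp_star P) (inner_mulOp_star Q)
    (n := n) (m := m)
    (fun s t h => by
      rw [hcoef, tint_monomial_mul_ev, neg_sub] at h
      have h1 : t - s ∈ boxSet (n + 1) (m + 1) := by
        by_contra h'
        exact h (mem_box.1 hm _ h')
      rw [mem_boxSet, Prod.fst_sub, Prod.snd_sub] at h1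
      push_cast at h1
      refine ⟨⟨by omega, by omega⟩, ⟨?_, ?_⟩⟩
      · simp only [Prod.fst_add]; omega
      · simp only [Prod.snd_add]; omega)
    (fun s t h => by
      rw [hcoef] at h
      by_contra h'
      apply h
      apply hp.tint_eq_zero hm
      rw [Prod.le_def] at h'
      rw [Prod.fst_sub, Prod.snd_sub]
      omega)
    (y := toL2 (contT_ev x).toC)
    (fun s hs => by
      rw [monBasis_apply]
      refine (inner_toL2 (contT_monomial s) (contT_ev x)).trans ?_
      rw [← mem_box.1 hx s hs]
      have h := tint_monomial_mul_ev (-s) x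
      rw [neg_neg] at h
      rw [← h]
      refine tint_congr fun z w hz hw => ?_
      simp only [map_mul, conj_zpow_of_norm hz, conj_zpow_of_norm hw, Prod.fst_neg, Prod.snd_neg]
      ring)
    (fun s hs => by
      rw [hmon, hinner]
      exact hxv _ (single_mem_box hs 1))
  -- All exponents of `box n (m + 1)` lie in the quarter plane covered by `key`.
  refine box_induction (P := fun y => pair (mom (dens p)) x y = 0) (by simp) ?_ ?_ hy
  · intro y y' h h'
    rw [pair_add_right, h, h', add_zero]
  · intro s hs a
    obtain ⟨⟨-, h1⟩, h2, -⟩ := mem_boxSet.1 hs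
    have h := key s h1 h2
    rw [hmon, hinner] at h
    have e : Finsupp.single s a = a • Finsupp.single s (1 : ℂ) := by simp
    rw [e, pair_smul_right, h, mul_zero]

end Bicircle

/-! ### Comparison of two Toeplitz forms. -/

namespace Bicircle

open Finset MeasureTheory
open scoped ComplexConjugate

section Radical

variable {c c' : ℤ × ℤ → ℂ} {n m : ℕ} {ψ : Fin n → Trig}

/-- A polynomial that vanishes on `w = 0` is divisible by `w`, so matching the values there
suffices. -/
lemma eq_sum_add_shift (hψ : ∀ k, ψ k ∈ box n (m + 1)) {y : Trig} (hy : y ∈ box n (m + 1))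
    (b : Fin n → ℂ) (hb : ∀ z, ∑ k, b k * ev z 0 (ψ k) = ev z 0 y) :
    ∃ h ∈ box n m, y = ∑ k, b k • ψ k + shift (0, 1) h := by
  have hr : y - ∑ k, b k • ψ k ∈ box n (m + 1) :=
    sub_mem hy (sum_mem fun k _ => Submodule.smul_mem _ _ (hψ k))
  obtain ⟨h, hm, hh⟩ := eq_shift_sub_smul (w := 0) hr fun z => by
    rw [map_sub, map_sum, ← hb, sub_eq_zero]
    simp
  refine ⟨h, hm, ?_⟩
  rw [zero_smul, sub_zero, sub_eq_iff_eq_add] at hh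
  rw [hh, add_comm]

/-- Invertibility of the coefficient matrix at `0` means that the `ψ k`, restricted to `w = 0`, span
the polynomials in `z` of degree `< n`. -/
lemma exists_eq_sum_add_shift (hψ : ∀ k, ψ k ∈ box n (m + 1))
    (hdet : (matPoly n m ψ).det.eval 0 ≠ 0) {y : Trig} (hy : y ∈ box n (m + 1)) :
    ∃ b : Fin n → ℂ, ∃ h ∈ box n m, y = ∑ k, b k • ψ k + shift (0, 1) h := by
  set M := (Polynomial.evalRingHom (0 : ℂ)).mapMatrix (matPoly n m ψ) with hM
  have hdM : IsUnit M.det := by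
    rw [hM, ← RingHom.map_det]; exact isUnit_iff_ne_zero.2 hdet
  set v : Fin n → ℂ := fun i => ∑ j : Fin (m + 1), y ((i : ℕ), (j : ℕ)) * (0 : ℂ) ^ (j : ℕ) with hv
  obtain ⟨u, hu⟩ : ∃ u, Matrix.vecMul u M = v := ⟨Matrix.vecMul v M⁻¹, by
    rw [Matrix.vecMul_vecMul, Matrix.nonsing_inv_mul _ hdM, Matrix.vecMul_one]⟩
  refine ⟨u, eq_sum_add_shift hψ hy _ fun z => ?_⟩
  rw [ev_eq_sum_mul hy]
  change _ = ∑ i, v i * z ^ (i : ℕ)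
  rw [← hu]
  simp only [ev_eq_matPoly hψ, Finset.mul_sum]
  rw [Finset.sum_comm]
  refine Finset.sum_congr rfl fun i _ => ?_
  conv_rhs => rw [Matrix.vecMul, dotProduct, Finset.sum_mul]
  refine Finset.sum_congr rfl fun k _ => ?_
  simp [hM, mul_assoc]

/-- Two inner products which agree when one argument is one of the `ψ k` agree on the box. -/
lemma IsPosDef.pair_eq_pair (hc : IsPosDef c) (hc' : IsPosDef c') (hO : OrthoFam c ψ)
    (hψ : ∀ k, ψ k ∈ box n (m + 1))
    (horth : ∀ k, ∀ x ∈ box n m, pair c (ψ k) (shift (0, 1) x) = 0)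
    (heq : ∀ k, ∀ x ∈ box n (m + 1), pair c (ψ k) x = pair c' (ψ k) x)
    {x y : Trig} (hx : x ∈ box n (m + 1)) (hy : y ∈ box n (m + 1)) : pair c x y = pair c' x y := by
  have hdet := hc.det_matPoly_ne_zero hO hψ horth (w := 0) (by simp)
  have hrefl : ∀ {x}, x ∈ box n (m + 1) → refl (n - 1, m) x ∈ box n (m + 1) := fun hx =>
    refl_mem_box hx (by simp) (by simp) (by simp) (by simp)
  have hs : ∀ {x}, x ∈ box n m → shift (0, 1) x ∈ box n (m + 1) := fun hx =>
    shift_mem_box hx (by simp) (by simp) (by simp) (by simp)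
  have hbb : ∀ {x}, x ∈ box n m → x ∈ box n (m + 1) := fun hx =>
    box_mono le_rfl (by omega) hx
  -- `R` is the radical of the difference of the two forms on the box; the goal is that it is
  -- everything.
  let R : Submodule ℂ Trig :=
    { carrier := {x | x ∈ box n (m + 1) ∧ ∀ y ∈ box n (m + 1), pair c x y = pair c' x y}
      zero_mem' := ⟨zero_mem _, by simp⟩
      add_mem' := fun ha hb => ⟨add_mem ha.1 hb.1, fun y hy => by
        rw [pair_add_left, pair_add_left, ha.2 y hy, hb.2 y hy]⟩
      smul_mem' := fun r a ha => ⟨Submodule.smul_mem _ _ ha.1, fun y hy => by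
        rw [pair_smul_left, pair_smul_left, ha.2 y hy]⟩ }
  have hRU : R ≤ box n (m + 1) := fun x hx => hx.1
  have : Module.Finite ℂ R := Submodule.finiteDimensional_of_le hRU
  have hψR : ∀ k, ψ k ∈ R := fun k => ⟨hψ k, heq k⟩
  have hφR : ∀ k, refl (n - 1, m) (ψ k) ∈ R := fun k => ⟨hrefl (hψ k), fun y hy => by
    have h1 := pair_refl c (n - 1, m) (ψ k) (refl (n - 1, m) y)
    have h2 := pair_refl c' (n - 1, m) (ψ k) (refl (n - 1, m) y)
    rw [refl_refl] at h1 h2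
    rw [h1, h2, ← hc.pair_conj, ← hc'.pair_conj, heq k _ (hrefl hy)]⟩
  -- Test vectors split into `ψ` terms, where the forms agree by hypothesis, and multiples of `w`,
  -- where the shift can be cancelled.
  have hshift : ∀ x ∈ R, x ∈ box n m → shift (0, 1) x ∈ R := by
    intro x hx hxm
    refine ⟨hs hxm, fun y hy => ?_⟩
    obtain ⟨b, h, hm, rfl⟩ := exists_eq_sum_add_shift hψ hdet hy
    rw [pair_add_right, pair_add_right, pair_shift, pair_shift, hx.2 h (hbb hm), pair_sum_right,
      pair_sum_right]
    congr 1
    refine Finset.sum_congr rfl fun k _ => ?_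
    rw [pair_smul_right, pair_smul_right, ← hc.pair_conj, ← hc'.pair_conj, heq k _ (hs hxm)]
  -- A vector orthogonal to `R` has no `ψ` part, so it is `w h`. The quotient `h` is again
  -- orthogonal to `R`: up to reflected `ψ k`, which are orthogonal to `box n m`, an element of `R`
  -- lies in `R ∩ box n m`, and `hshift` applies to it.
  have hstep : ∀ y ∈ box n (m + 1), (∀ r ∈ R, pair c y r = 0) →
      ∃ h ∈ box n m, y = shift (0, 1) h ∧ ∀ r ∈ R, pair c h r = 0 := by
    intro y hy hyR
    obtain ⟨b, h, hm, rfl⟩ := exists_eq_sum_add_shift hψ hdet hy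
    have hb : b = 0 := by
      funext l
      have h1 := hyR _ (hψR l)
      rw [pair_add_left, hO.pair_sum, hc.pair_comm_zero (horth l h hm), add_zero] at h1
      exact h1
    have e : ∑ k, b k • ψ k + shift (0, 1) h = shift (0, 1) h := by simp [hb]
    rw [e] at hyR ⊢
    refine ⟨h, hm, rfl, fun r hr => ?_⟩
    obtain ⟨b', h', hm', hr'⟩ := exists_eq_sum_add_shift hψ hdet (hrefl hr.1)
    have hφ : ∀ k, pair c h (refl (n - 1, m) (ψ k)) = 0 := by
      intro k
      have h1 := pair_refl c (n - 1, m) (refl (n - 1, m) h) (ψ k)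
      rw [refl_refl] at h1
      rw [h1]
      have e2 : refl (n - 1, m) h = shift (0, 1) (refl (n - 1, m - 1) h) := by
        rw [shift_refl]; simp
      rw [e2]
      exact horth k _ (refl_mem_box hm (by simp) (by simp) (by simp) (by simp))
    have hr2 : r = ∑ k, conj (b' k) • refl (n - 1, m) (ψ k) +
        refl (n - 1, m) (shift (0, 1) h') := by
      rw [← refl_refl (n - 1, m) r, hr', refl_add]
      congr 1
      ext t
      simp [Finsupp.finsetSum_apply]
    have hr0m : refl (n - 1, m) (shift (0, 1) h') ∈ box n m := by
      have e2 : refl (n - 1, m) (shift (0, 1) h') = refl (n - 1, m - 1) h' := by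
        ext t
        simp only [refl_apply, shift_apply]
        congr 2
        ext <;> simp; ring
      rw [e2]
      exact refl_mem_box hm' (by simp) (by simp) (by simp) (by simp)
    have hr0R : refl (n - 1, m) (shift (0, 1) h') ∈ R := by
      have : refl (n - 1, m) (shift (0, 1) h') =
          r - ∑ k, conj (b' k) • refl (n - 1, m) (ψ k) := by rw [eq_sub_iff_add_eq, add_comm, ← hr2]
      rw [this]
      exact sub_mem hr (sum_mem fun k _ => Submodule.smul_mem _ _ (hφR k))
    rw [hr2, pair_add_right, pair_sum_right, Finset.sum_eq_zero, zero_add]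
    · rw [← pair_shift c (0, 1)]
      exact hyR _ (hshift _ hr0R hr0m)
    · intro k _
      rw [pair_smul_right, hφ, mul_zero]
  have hiter : ∀ N : ℕ, ∀ y ∈ box n (m + 1), (∀ r ∈ R, pair c y r = 0) →
      ∃ h ∈ box n (m + 1), y = shift (0, N) h := by
    intro N
    induction N with
    | zero => exact fun y hy _ => ⟨y, hy, by
        ext t; rw [shift_apply]; congr 1; ext <;> simp⟩
    | succ N ih =>
      intro y hy hyR
      obtain ⟨h, hm, rfl, hhR⟩ := hstep y hy hyR
      obtain ⟨h', hm', rfl⟩ := ih h (hbb hm) hhR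
      refine ⟨h', hm', ?_⟩
      ext t
      simp only [shift_apply]
      congr 1
      ext <;> simp; ring
  -- Divisibility by `w^(m+1)` exceeds the degree in `w`.
  have hzero : ∀ y ∈ box n (m + 1), (∀ r ∈ R, pair c y r = 0) → y = 0 := by
    intro y hy hyR
    obtain ⟨h, hm, hh⟩ := hiter (m + 1) y hy hyR
    ext t
    by_cases ht : t ∈ boxSet n (m + 1)
    · rw [hh, shift_apply]
      apply mem_box.1 hm
      simp only [mem_boxSet, Prod.snd_sub] at *
      omega
    · exact mem_box.1 hy t ht
  have hR : R = box n (m + 1) := by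
    by_contra hne
    have hlt : Module.finrank ℂ R < Module.finrank ℂ (box n (m + 1)) :=
      Submodule.finrank_lt_finrank_of_lt (lt_of_le_of_ne hRU hne)
    obtain ⟨v, hv, hvU, hvR⟩ := hc.exists_orthoFam hRU
      (d := Module.finrank ℂ (box n (m + 1)) - Module.finrank ℂ R) (by omega)
    have hv0 := hzero _ (hvU ⟨0, by omega⟩) (hvR _)
    have := hv.1 ⟨0, by omega⟩
    rw [hv0, pair_zero_left] at this
    exact zero_ne_one this
  rw [← hR] at hx
  exact hx.2 y hy

end Radical

/-! ### The reproducing kernel for the weight `1/|p|²` on fibres `|w| = 1`. -/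

section Fibre

variable {n m : ℕ} {p : Trig} {ψ : Fin n → Trig}

lemma continuous_ev_left {a b : ℕ} {x : Trig} (hx : x ∈ box a b) (w : ℂ) :
    Continuous fun t : Ang => ev (U t) w x :=
  (differentiable_ev_left hx w).continuous.comp continuous_U

/-- The reproducing property on a fibre of the torus. -/
lemma sum_integral_mul_ev (hp : Stable p) (hm : p ∈ box (n + 1) (m + 1))
    (hψ : ∀ k, ψ k ∈ box n (m + 1)) {w : ℂ} (hw : ‖w‖ = 1)
    (hCD : ∀ z z' : ℂ, ev z w p * conj (ev z' w p) -
      ev z w (refl (n, m) p) * conj (ev z' w (refl (n, m) p)) =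
      (1 - z * conj z') * ∑ k, ev z w (ψ k) * conj (ev z' w (ψ k)))
    (i : Fin n) {z : ℂ} (hz : ‖z‖ < 1) :
    ∑ k, (∫ t, U t ^ (i : ℕ) * conj (ev (U t) w (ψ k)) * dens p (U t) w ∂μ₁) * ev z w (ψ k) =
      z ^ (i : ℕ) := by
  have hp0 : ∀ t, ev (U t) w p ≠ 0 := fun t => hp _ _ (norm_U t).le hw.le
  have hcd : Continuous fun t : Ang => dens p (U t) w := by
    unfold dens
    exact Continuous.inv₀ ((continuous_ev_left hm w).mul
      (Complex.continuous_conj.comp (continuous_ev_left hm w)))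
      fun t => mul_ne_zero (hp0 t) (by simpa using hp0 t)
  have e1 : ∀ k, (∫ t, U t ^ (i : ℕ) * conj (ev (U t) w (ψ k)) * dens p (U t) w ∂μ₁) *
      ev z w (ψ k) = ∫ t, U t ^ (i : ℕ) * dens p (U t) w *
        (ev z w (ψ k) * conj (ev (U t) w (ψ k))) ∂μ₁ := by
    intro k
    rw [← integral_mul_const]
    congr 1; funext t; ring
  simp only [e1]
  have hint : ∀ k, Integrable (fun t => U t ^ (i : ℕ) * dens p (U t) w *
      (ev z w (ψ k) * conj (ev (U t) w (ψ k)))) μ₁ := fun k => integrable_one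
    (((continuous_U.pow _).mul hcd).mul (continuous_const.mul
      (Complex.continuous_conj.comp (continuous_ev_left (hψ k) w))))
  rw [← integral_finsetSum _ fun k _ => hint k]
  have hne : ∀ t : Ang, U t - z ≠ 0 := fun t h => by
    have h1 := norm_U t
    rw [sub_eq_zero.1 h] at h1
    linarith
  have hni : 0 < (n : ℤ) - i := by have := i.2; omega
  set F : ℂ → ℂ := fun u => (1 - conj z * u)⁻¹ * (ev u w p)⁻¹ with hF
  have hFd : DiffContOnCl ℂ F (Metric.ball 0 1) := by
    have h1 : DiffContOnCl ℂ (fun u => (1 - conj z * u)⁻¹) (Metric.ball 0 1) := by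
      refine DiffContOnCl.inv (Differentiable.diffContOnCl (by fun_prop)) fun u hu h => ?_
      rw [closure_ball _ one_ne_zero, mem_closedBall_zero_iff] at hu
      have h1 : ‖conj z * u‖ = 1 := by rw [← sub_eq_zero.1 h]; simp
      rw [norm_mul, Complex.norm_conj] at h1
      nlinarith [norm_nonneg u, norm_nonneg z]
    exact h1.smul (hp.diffContOnCl_left hm hw.le)
  have hGd : DiffContOnCl ℂ (fun u => u ^ (i : ℕ) * (ev u w p)⁻¹) (Metric.ball 0 1) :=
    DiffContOnCl.smul (Differentiable.diffContOnCl (differentiable_pow _))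
      (hp.diffContOnCl_left hm hw.le)
  -- Dividing the Christoffel–Darboux formula by `1 - z Ū` leaves a Cauchy kernel applied to `u^i /
  -- p`, which reproduces its value at `z`, and the conjugate of `u^(n-i) F(u)`. The latter is
  -- analytic and vanishes at the origin because `i < n`, so it integrates to zero.
  have e2 : ∀ t, ∑ k, U t ^ (i : ℕ) * dens p (U t) w *
        (ev z w (ψ k) * conj (ev (U t) w (ψ k))) =
      ev z w p * (U t / (U t - z) * (U t ^ (i : ℕ) * (ev (U t) w p)⁻¹)) -
      ev z w (refl (n, m) p) * (conj w) ^ m * conj (U t ^ ((n : ℤ) - i) * F (U t)) := by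
    intro t
    have hd : 1 - z * conj (U t) ≠ 0 := by
      rw [conj_U]
      intro h
      apply hne t
      have := U_ne_zero t
      field_simp at h
      simpa using h
    rw [← Finset.mul_sum, (eq_div_iff hd).2 ((mul_comm _ _).trans (hCD z (U t)).symm),
      ev_refl (norm_U t) hw]
    have hpt := hp0 t
    have hpt' : conj (ev (U t) w p) ≠ 0 := by simpa using hpt
    have hU := U_ne_zero t
    have hUz := hne t
    have hd' : 1 - z * (U t)⁻¹ ≠ 0 := by rwa [conj_U] at hd
    simp only [hF, dens, map_mul, map_inv₀, map_sub, map_one, Complex.conj_conj,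
      conj_U, ← Complex.inv_eq_conj hw, 
      zpow_sub₀ hU, zpow_natCast, map_pow, map_div₀, inv_pow]
    have hw0 : w ≠ 0 := by rintro rfl; simp at hw
    field_simp
  simp only [e2]
  rw [integral_sub, integral_const_mul, integral_const_mul, integral_cauchy hGd hz, integral_conj,
    integral_pow_mul_analytic hFd hni]
  · have := hp z w hz.le hw.le
    field_simp
    simp
  · refine integrable_one (continuous_const.mul ((continuous_U.div (continuous_U.sub
      continuous_const) hne).mul ((continuous_U.pow _).mul
        (Continuous.inv₀ (continuous_ev_left hm w) hp0))))
  · refine integrable_one (continuous_const.mul (Complex.continuous_conj.comp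
      ((Continuous.zpow₀ continuous_U _ fun t => Or.inl (U_ne_zero t)).mul
        ((Continuous.inv₀ (continuous_const.sub (continuous_const.mul continuous_U)) fun t h => ?_).mul
          (Continuous.inv₀ (continuous_ev_left hm w) hp0)))))
    have h : 1 - conj z * U t = 0 := h
    have h1 : ‖conj z * U t‖ = 1 := by rw [← sub_eq_zero.1 h]; simp
    rw [norm_mul, Complex.norm_conj, norm_U] at h1
    linarith

end Fibre

end Bicircle

namespace Bicircle

open Finset MeasureTheory
open scoped ComplexConjugate

section Fibre

variable {c : ℤ × ℤ → ℂ} {n m : ℕ} {p : Trig} {ψ : Fin n → Trig}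

lemma map_adjugate_mul (M : Matrix (Fin n) (Fin n) (Polynomial ℂ)) (w : ℂ) (i j : Fin n) :
    ∑ k, (M.adjugate i k).eval w * (M k j).eval w = if i = j then M.det.eval w else 0 := by
  have h := congrArg (fun P => Polynomial.eval w P) (congrFun (congrFun (M.adjugate_mul) i) j)
  simp only [Matrix.mul_apply, Polynomial.eval_finsetSum, Polynomial.eval_mul] at h
  rw [h]
  split_ifs with hij <;> simp [hij]

lemma mul_map_adjugate (M : Matrix (Fin n) (Fin n) (Polynomial ℂ)) (w : ℂ) (i j : Fin n) :
    ∑ k, (M i k).eval w * (M.adjugate k j).eval w = if i = j then M.det.eval w else 0 := by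
  have h := congrArg (fun P => Polynomial.eval w P) (congrFun (congrFun (M.mul_adjugate) i) j)
  simp only [Matrix.mul_apply, Polynomial.eval_finsetSum, Polynomial.eval_mul] at h
  rw [h]
  split_ifs with hij <;> simp [hij]

/-- Comparing coefficients of powers of `z` in the reproducing property shows that the fibre
integrals form the inverse of the coefficient matrix. -/
lemma integral_mul_det (hp : Stable p) (hm : p ∈ box (n + 1) (m + 1))
    (hψ : ∀ k, ψ k ∈ box n (m + 1)) {w : ℂ} (hw : ‖w‖ = 1)
    (hCD : ∀ z z' : ℂ, ev z w p * conj (ev z' w p) -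
      ev z w (refl (n, m) p) * conj (ev z' w (refl (n, m) p)) =
      (1 - z * conj z') * ∑ k, ev z w (ψ k) * conj (ev z' w (ψ k)))
    (i k : Fin n) :
    (∫ t, U t ^ (i : ℕ) * conj (ev (U t) w (ψ k)) * dens p (U t) w ∂μ₁) *
      (matPoly n m ψ).det.eval w = ((matPoly n m ψ).adjugate i k).eval w := by
  set A : Fin n → ℂ :=
    fun k => ∫ t, U t ^ (i : ℕ) * conj (ev (U t) w (ψ k)) * dens p (U t) w ∂μ₁ with hA
  have h1 : ∀ j, ∑ k, A k * (matPoly n m ψ k j).eval w = if i = j then 1 else 0 := by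
    have h2 : (fun j => ∑ k, A k * (matPoly n m ψ k j).eval w - if i = j then 1 else 0) = 0 := by
      apply coeff_eq_zero_of_forall_sum
      intro z hz
      have h3 := sum_integral_mul_ev hp hm hψ hw hCD i hz
      simp only [ev_eq_matPoly hψ, Finset.mul_sum] at h3
      rw [Finset.sum_comm] at h3
      simp only [← ev_eq_matPoly hψ] at h3
      simp only [sub_mul, Finset.sum_sub_distrib, ite_mul, one_mul, zero_mul,
        Finset.sum_ite_eq, Finset.mem_univ, if_true]
      rw [sub_eq_zero, ← h3]
      refine Finset.sum_congr rfl fun j _ => ?_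
      rw [Finset.sum_mul]
      exact Finset.sum_congr rfl fun k _ => mul_assoc _ _ _
    intro j
    exact sub_eq_zero.1 (congrFun h2 j)
  change A k * _ = _
  have h4 : ∑ l, A l * ∑ j, (matPoly n m ψ l j).eval w * ((matPoly n m ψ).adjugate j k).eval w =
      ∑ j, (∑ l, A l * (matPoly n m ψ l j).eval w) * ((matPoly n m ψ).adjugate j k).eval w := by
    simp only [Finset.mul_sum, Finset.sum_mul]
    rw [Finset.sum_comm]
    simp only [mul_assoc]
  simpa [mul_map_adjugate, h1] using h4

/-- The fibre integral is an entry of the inverse matrix, analytic in `w` on the disc because the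
determinant has no zero there; the mean value property evaluates the remaining integral at `w = 0`.
-/
lemma pair_dens_single (hp : Stable p) (hm : p ∈ box (n + 1) (m + 1))
    (hψ : ∀ k, ψ k ∈ box n (m + 1))
    (hdet : ∀ w : ℂ, ‖w‖ ≤ 1 → (matPoly n m ψ).det.eval w ≠ 0)
    (hCD : ∀ z z' w : ℂ, ‖w‖ = 1 → ev z w p * conj (ev z' w p) -
      ev z w (refl (n, m) p) * conj (ev z' w (refl (n, m) p)) =
      (1 - z * conj z') * ∑ k, ev z w (ψ k) * conj (ev z' w (ψ k)))
    (i k : Fin n) (j : ℕ) :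
    pair (mom (dens p)) (Finsupp.single ((i : ℕ), (j : ℕ)) 1) (ψ k) =
      0 ^ j * (((matPoly n m ψ).adjugate i k).eval 0 * ((matPoly n m ψ).det.eval 0)⁻¹) := by
  rw [pair_mom hp.contT_dens, tint_eq_symm _
    (((contT_ev _).mul (contT_ev _).conj).mul hp.contT_dens)]
  have hF : DiffContOnCl ℂ (fun w => w ^ j * (((matPoly n m ψ).adjugate i k).eval w *
      ((matPoly n m ψ).det.eval w)⁻¹)) (Metric.ball 0 1) := by
    have h1 : DiffContOnCl ℂ (fun w => ((matPoly n m ψ).det.eval w)⁻¹) (Metric.ball 0 1) :=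
      (Polynomial.differentiable _).diffContOnCl.inv fun w hw => hdet w (by
        rw [closure_ball _ one_ne_zero] at hw; simpa using hw)
    exact (differentiable_pow j).diffContOnCl.smul
      ((Polynomial.differentiable _).diffContOnCl.smul h1)
  rw [← integral_analytic hF]
  congr 1
  funext t
  rw [← integral_mul_det hp hm hψ (norm_U t) (fun z z' => hCD z z' _ (norm_U t)) i k,
    mul_inv_cancel_right₀ (hdet _ (norm_U t).le), ← integral_const_mul]
  congr 1
  funext s
  simp only [ev_single, one_mul, zpow_natCast]
  ring

/-- Modulo multiples of `w`, to which the `ψ k` are orthogonal, the monomial is a combination of the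
`ψ k` whose coefficients are read off from the inverse matrix at `0`. For `j > 0` it is itself a
multiple of `w`, hence the factor `0 ^ j`. -/
lemma IsPosDef.pair_single_eq (hc : IsPosDef c) (hO : OrthoFam c ψ)
    (hψ : ∀ k, ψ k ∈ box n (m + 1))
    (horth : ∀ k, ∀ x ∈ box n m, pair c (ψ k) (shift (0, 1) x) = 0)
    (hdet : (matPoly n m ψ).det.eval 0 ≠ 0) (i k : Fin n) {j : ℕ} (hj : j ≤ m) :
    pair c (Finsupp.single ((i : ℕ), (j : ℕ)) 1) (ψ k) =
      0 ^ j * (((matPoly n m ψ).adjugate i k).eval 0 * ((matPoly n m ψ).det.eval 0)⁻¹) := by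
  have hy : (Finsupp.single (((i : ℕ) : ℤ), (j : ℤ)) (1 : ℂ)) ∈ box n (m + 1) :=
    single_mem_box (by rw [mem_boxSet]; have := i.2; dsimp only; omega) _
  obtain ⟨h, hm, hh⟩ := eq_sum_add_shift hψ hy (fun k => 0 ^ j *
      (((matPoly n m ψ).adjugate i k).eval 0 * ((matPoly n m ψ).det.eval 0)⁻¹)) fun z => by
    simp only [ev_eq_matPoly hψ, Finset.mul_sum, ev_single, zpow_natCast]
    rw [Finset.sum_comm]
    have e : ∀ l : Fin n, ∑ k, 0 ^ j * (((matPoly n m ψ).adjugate i k).eval 0 *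
        ((matPoly n m ψ).det.eval 0)⁻¹) * ((matPoly n m ψ k l).eval 0 * z ^ (l : ℕ)) =
        (if i = l then (matPoly n m ψ).det.eval 0 else 0) *
          ((0 ^ j * ((matPoly n m ψ).det.eval 0)⁻¹) * z ^ (l : ℕ)) := fun l => by
      rw [← map_adjugate_mul, Finset.sum_mul]
      exact Finset.sum_congr rfl fun k _ => by ring
    simp only [e, ite_mul, zero_mul, Finset.sum_ite_eq, Finset.mem_univ, if_true]
    field_simp
  rw [hh, pair_add_left, hO.pair_sum, hc.pair_comm_zero (horth k h hm), add_zero]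

end Fibre

/-! ### Agreement of the moments of the given form and of `1/|p|²`. -/

section Match

variable {c : ℤ × ℤ → ℂ} {n m : ℕ} {p : Trig}

/-- Both forms take the same values on pairs of a monomial and a `ψ k`, so `pair_eq_pair` makes them
agree on `box n (m + 1)`, whose differences of exponents fill this range. -/
lemma IsPosDef.moment_eq_left (hc : IsPosDef c) (hK : SplitOrth c n m)
    (hp : IsExtremal c n m p) {s : ℤ × ℤ} (h1 : |s.1| < n) (h2 : |s.2| ≤ m) :
    c s = mom (dens p) s := by
  have hst : Stable p := fun z w hz hw => hc.ev_ne_zero hK hp hz hw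
  obtain ⟨ε, ψ, hO, hψ, horth, hCD⟩ := hc.christoffel_darboux hK hp
  have hdet : ∀ w : ℂ, ‖w‖ ≤ 1 → (matPoly n m ψ).det.eval w ≠ 0 :=
    fun w hw => hc.det_matPoly_ne_zero hO hψ horth hw
  have hCD' : ∀ z z' w : ℂ, ‖w‖ = 1 → ev z w p * conj (ev z' w p) -
      ev z w (refl (n, m) p) * conj (ev z' w (refl (n, m) p)) =
      (1 - z * conj z') * ∑ k, ev z w (ψ k) * conj (ev z' w (ψ k)) := fun z z' w hw => by
    rw [hCD, Complex.mul_conj', hw]; simp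
  have hx : ∀ k, ∀ x ∈ box n (m + 1), pair c x (ψ k) = pair (mom (dens p)) x (ψ k) := by
    intro k x hx
    refine box_induction (P := fun x => pair c x (ψ k) = pair (mom (dens p)) x (ψ k))
      (by simp) (fun x y hx hy => by rw [pair_add_left, pair_add_left, hx, hy]) ?_ hx
    rintro ⟨i, j⟩ hs a
    rw [mem_boxSet] at hs
    dsimp only at hs
    obtain ⟨i, rfl⟩ := Int.eq_ofNat_of_zero_le hs.1.1
    obtain ⟨j, rfl⟩ := Int.eq_ofNat_of_zero_le hs.2.1
    have e : Finsupp.single ((i : ℤ), (j : ℤ)) a = a • Finsupp.single ((i : ℤ), (j : ℤ)) (1 : ℂ) := by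
      simp
    rw [e, pair_smul_left, pair_smul_left]
    congr 1
    exact (hc.pair_single_eq hO hψ horth (hdet 0 (by simp)) ⟨i, by omega⟩ k (by omega)).trans
      (pair_dens_single hst hp.mem hψ hdet hCD' ⟨i, by omega⟩ k j).symm
  -- The positive and negative parts of `s` are two exponents of the box with difference `s`.
  have key := hc.pair_eq_pair hst.isPosDef hO hψ horth (fun k x hx' => by
    rw [← hc.pair_conj, hx k x hx', hst.isPosDef.pair_conj])
    (x := Finsupp.single (max s.1 0, max s.2 0) 1) (y := Finsupp.single (max (-s.1) 0, max (-s.2) 0) 1)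
    (single_mem_box (by rw [mem_boxSet]; dsimp only; rw [abs_lt] at h1; rw [abs_le] at h2; omega) _)
    (single_mem_box (by rw [mem_boxSet]; dsimp only; rw [abs_lt] at h1; rw [abs_le] at h2; omega) _)
  rw [pair_single, pair_single, map_one, one_mul, one_mul] at key
  have e : (max s.1 0, max s.2 0) - (max (-s.1) 0, max (-s.2) 0) = s := by
    ext
    · simp only [Prod.fst_sub]; omega
    · simp only [Prod.snd_sub]; omega
  rwa [e, one_mul] at key

lemma dens_swapT (p : Trig) : dens (swapT p) = fun z w => dens p w z := by
  funext z w
  rw [dens, dens, ev_swapT]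

lemma IsPosDef.moment_eq_right (hc : IsPosDef c) (hK : SplitOrth c n m)
    (hp : IsExtremal c n m p) {s : ℤ × ℤ} (h1 : |s.1| ≤ n) (h2 : |s.2| < m) :
    c s = mom (dens p) s := by
  have := hc.swap.moment_eq_left (hK.swap hc) hp.swap (s := s.swap) h2 h1
  rwa [dens_swapT, ← mom_swap, Prod.swap_swap] at this

lemma Stable.tint_inv (hp : Stable p) {a b : ℕ} (hm : p ∈ box (a + 1) (b + 1)) :
    tint (fun z w => (ev z w p)⁻¹) = (p 0)⁻¹ := by
  rw [tint_eq _ hp.contT_inv]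
  have e : ∀ s : Ang, ∫ t, (ev (U s) (U t) p)⁻¹ ∂μ₁ = (ev (U s) 0 p)⁻¹ := fun s =>
    integral_analytic (hp.diffContOnCl_right hm (norm_U s).le)
  simp only [e]
  rw [integral_analytic (hp.diffContOnCl_left hm (w := 0) (by simp)), ev_eq_sum hm,
    Fin.sum_univ_succ, Fin.sum_univ_succ]
  simp
  rfl

/-- On the torus `p / |p|²` is the conjugate of `1/p`, which has no negative frequencies and
constant term `1 / p(0)`. Thus `p` satisfies for its own density the orthogonality of `IsExtremal`.
-/
lemma Stable.pair_dens_single (hp : Stable p) {a b : ℕ} (hm : p ∈ box (a + 1) (b + 1))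
    {s : ℤ × ℤ} (h1 : 0 ≤ s.1) (h2 : 0 ≤ s.2) :
    pair (mom (dens p)) p (Finsupp.single s 1) = if s = 0 then conj (p 0)⁻¹ else 0 := by
  rw [pair_mom hp.contT_dens]
  have e : tint (fun z w => ev z w p * conj (ev z w (Finsupp.single s 1)) * dens p z w) =
      conj (tint fun z w => z ^ s.1 * w ^ s.2 * (ev z w p)⁻¹) := by
    rw [← tint_conj]
    refine tint_congr fun z w hz hw => ?_
    have := hp z w hz.le hw.le
    simp only [ev_single, dens, map_mul, one_mul, map_inv₀, mul_inv]
    field_simp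
  rw [e]
  split_ifs with hs
  · simp [hs, hp.tint_inv hm]
  · rw [hp.tint_eq_zero hm, map_zero]
    by_contra! h
    exact hs (Prod.ext (by simp; omega) (by simp; omega))

/-- In the product of `p` with `z^n w^m`, which has the same value for both forms, the corner moment
is multiplied by `p(0) ≠ 0` and every other moment is already matched. -/
lemma IsPosDef.moment_eq_corner (hc : IsPosDef c) (hK : SplitOrth c n m)
    (hp : IsExtremal c n m p) : c (-n, -m) = mom (dens p) (-n, -m) := by
  have hst : Stable p := fun z w hz hw => hc.ev_ne_zero hK hp hz hw
  have hp0 : p 0 ≠ 0 := fun h =>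
    left_ne_zero_of_mul_eq_one hp.pair_one (by rw [h, map_zero])
  set s : ℤ × ℤ := (n, m) with hs
  have h1 : pair c p (Finsupp.single s 1) = pair (mom (dens p)) p (Finsupp.single s 1) := by
    rw [hst.pair_dens_single hp.mem (by simp [hs]) (by simp [hs])]
    split_ifs with h
    · rw [h, map_inv₀]
      exact eq_inv_of_mul_eq_one_right hp.pair_one
    · exact hp.orth s (by rw [mem_boxSet]; simp [hs]) h
  have h2 : ∀ t ∈ (p.erase 0).support, c (t - s) = mom (dens p) (t - s) := by
    intro t ht
    rw [Finsupp.support_erase, Finset.mem_erase, Finsupp.mem_support_iff] at ht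
    have htb : t ∈ boxSet (n + 1) (m + 1) := by
      by_contra h
      exact ht.2 (mem_box.1 hp.mem t h)
    rw [mem_boxSet] at htb
    by_cases h0 : 0 < t.1
    · apply hc.moment_eq_left hK hp
      · rw [abs_lt]; simp only [hs, Prod.fst_sub]; omega
      · rw [abs_le]; simp only [hs, Prod.snd_sub]; omega
    · have : 0 < t.2 := by
        by_contra h
        exact ht.1 (Prod.ext (by simp; omega) (by simp; omega))
      apply hc.moment_eq_right hK hp
      · rw [abs_le]; simp only [hs, Prod.fst_sub]; omega
      · rw [abs_lt]; simp only [hs, Prod.snd_sub]; omega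
  have h3 : pair c (p.erase 0) (Finsupp.single s 1) =
      pair (mom (dens p)) (p.erase 0) (Finsupp.single s 1) := by
    refine Finset.sum_congr rfl fun t ht => ?_
    dsimp only
    rw [Finsupp.sum_single_index (by simp), Finsupp.sum_single_index (by simp), h2 t ht]
  rw [← Finsupp.single_add_erase 0 p, pair_add_left, pair_add_left, Finsupp.single_add_erase, h3,
    add_left_inj, pair_single, pair_single] at h1
  have := mul_left_cancel₀ (by simpa using hp0) h1
  simpa [hs] using this

lemma IsPosDef.exists_sub_orth (hc : IsPosDef c) (S : Submodule ℂ Trig) [Module.Finite ℂ S]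
    (x : Trig) : ∃ v ∈ S, ∀ y ∈ S, pair c (x - v) y = 0 := by
  obtain ⟨v, hv, hvS, -⟩ := hc.exists_orthoFam (bot_le : ⊥ ≤ S) (d := Module.finrank ℂ S) (by simp)
  refine ⟨∑ i, pair c x (v i) • v i, sum_mem fun i _ => Submodule.smul_mem _ _ (hvS i),
    fun y hy => ?_⟩
  rw [hv.eq_sum hvS (by simp) hy, pair_sum_right]
  refine Finset.sum_eq_zero fun i _ => ?_
  rw [pair_smul_right, pair_sub_left, hv.pair_sum, sub_self, mul_zero]

/-- The residuals of `z^n` and `w^m` modulo `box n m` are orthogonal for both forms: by hypothesis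
for `c`, by `Stable.splitOrth` for `1/|p|²`. In this relation the product of `z^n` and `w^m` is the
only term whose moment is not yet matched. -/
lemma IsPosDef.moment_eq_anticorner (hc : IsPosDef c) (hK : SplitOrth c n m)
    (hp : IsExtremal c n m p) (hn : 0 < n) (hm : 0 < m) : c (n, -m) = mom (dens p) (n, -m) := by
  have hst : Stable p := fun z w hz hw => hc.ev_ne_zero hK hp hz hw
  set e : Trig := Finsupp.single ((n : ℤ), (0 : ℤ)) 1
  set f : Trig := Finsupp.single ((0 : ℤ), (m : ℤ)) 1
  have he : e ∈ box (n + 1) m := single_mem_box (by rw [mem_boxSet]; dsimp only; omega) _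
  have hf : f ∈ box n (m + 1) := single_mem_box (by rw [mem_boxSet]; dsimp only; omega) _
  have hL : ∀ {x y}, x ∈ box n (m + 1) → y ∈ box n (m + 1) →
      pair c x y = pair (mom (dens p)) x y := fun hx hy => pair_congr hx hy fun s hs t ht => by
    rw [mem_boxSet] at hs ht
    apply hc.moment_eq_left hK hp
    · rw [abs_lt]; simp only [Prod.fst_sub]; omega
    · rw [abs_le]; simp only [Prod.snd_sub]; omega
  have hR : ∀ {x y}, x ∈ box (n + 1) m → y ∈ box (n + 1) m →
      pair c x y = pair (mom (dens p)) x y := fun hx hy => pair_congr hx hy fun s hs t ht => by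
    rw [mem_boxSet] at hs ht
    apply hc.moment_eq_right hK hp
    · rw [abs_le]; simp only [Prod.fst_sub]; omega
    · rw [abs_lt]; simp only [Prod.snd_sub]; omega
  obtain ⟨v, hv, hev⟩ := hc.exists_sub_orth (box n m) e
  obtain ⟨u, hu, hfu⟩ := hc.exists_sub_orth (box n m) f
  have l1 : box n m ≤ box (n + 1) m := box_mono (by omega) le_rfl
  have l2 : box n m ≤ box n (m + 1) := box_mono le_rfl (by omega)
  have k1 := hK _ (sub_mem he (l1 hv)) _ (sub_mem hf (l2 hu)) hev hfu
  have k2 := hst.splitOrth hp.mem _ (sub_mem he (l1 hv)) _ (sub_mem hf (l2 hu))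
    (fun y hy => by rw [← hR (sub_mem he (l1 hv)) (l1 hy), hev y hy])
    (fun y hy => by rw [← hL (sub_mem hf (l2 hu)) (l2 hy), hfu y hy])
  rw [pair_sub_right, pair_sub_left, hR (sub_mem he (l1 hv)) (l1 hu), hL (l2 hv) hf] at k1
  rw [pair_sub_right, pair_sub_left] at k2
  have k3 : pair c e f = pair (mom (dens p)) e f := by linear_combination k1 - k2
  simpa [e, f, pair_single] using k3

/-- Under the splitting condition, the moments of `1 / |p|²` agree with the given ones. -/
theorem IsPosDef.moment_eq (hc : IsPosDef c) (hK : SplitOrth c n m) (hp : IsExtremal c n m p)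
    {s : ℤ × ℤ} (h1 : |s.1| ≤ n) (h2 : |s.2| ≤ m) : c s = mom (dens p) s := by
  have hst : Stable p := fun z w hz hw => hc.ev_ne_zero hK hp hz hw
  have hneg : ∀ {s}, c (-s) = mom (dens p) (-s) → c s = mom (dens p) s := fun {s} h => by
    rw [← Complex.conj_conj (c s), ← hc.herm, h, hst.isPosDef.herm, Complex.conj_conj]
  have hc1 := hc.moment_eq_corner hK hp
  by_cases h1' : |s.1| < n
  · exact hc.moment_eq_left hK hp h1' h2
  by_cases h2' : |s.2| < m
  · exact hc.moment_eq_right hK hp h1 h2'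
  obtain ⟨a, b⟩ := s
  dsimp only at *
  have ha : |a| = (n : ℤ) := by omega
  have hb : |b| = (m : ℤ) := by omega
  rcases (abs_eq (by omega)).1 ha with rfl | rfl <;> rcases (abs_eq (by omega)).1 hb with rfl | rfl
  · exact hneg hc1
  · rcases Nat.eq_zero_or_pos n with rfl | hn
    · simpa using hc1
    rcases Nat.eq_zero_or_pos m with rfl | hm
    · exact hneg (by simpa using hc1)
    exact hc.moment_eq_anticorner hK hp hn hm
  · rcases Nat.eq_zero_or_pos n with rfl | hn
    · exact hneg (by simpa using hc1)
    rcases Nat.eq_zero_or_pos m with rfl | hm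
    · simpa using hc1
    exact hneg (by simpa using hc.moment_eq_anticorner hK hp hn hm)
  · exact hc1

end Match

end Bicircle

/-! ### Recovery of the density from its moments. -/

namespace Bicircle

open Finset MeasureTheory
open scoped ComplexConjugate

section Density

variable {n m : ℕ} {F p : Trig}

lemma contT_inv_ev (hF : ∀ z w, ‖z‖ = 1 → ‖w‖ = 1 → (ev z w F).im = 0 ∧ 0 < (ev z w F).re) :
    ContT fun z w => (ev z w F)⁻¹ :=
  (contT_ev F).inv fun z w hz hw h => by
    have := (hF z w hz hw).2
    rw [h] at this
    simp at this

lemma isPosDef_mom_inv_ev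
    (hF : ∀ z w, ‖z‖ = 1 → ‖w‖ = 1 → (ev z w F).im = 0 ∧ 0 < (ev z w F).re) :
    IsPosDef (mom fun z w => (ev z w F)⁻¹) :=
  isPosDef_mom (contT_inv_ev hF) (r := fun z w => (ev z w F).re⁻¹) fun z w hz hw => by
    obtain ⟨h1, h2⟩ := hF z w hz hw
    refine ⟨?_, inv_pos.2 h2⟩
    rw [Complex.ofReal_inv]
    congr 1
    apply Complex.ext <;> simp [h1]

/-- A positive trigonometric polynomial is determined by finitely many moments of its inverse. -/
lemma ev_eq_of_moment_eq
    (hF : ∀ z w, ‖z‖ = 1 → ‖w‖ = 1 → (ev z w F).im = 0 ∧ 0 < (ev z w F).re)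
    (hFm : F ∈ Finsupp.supported ℂ ℂ {s : ℤ × ℤ | |s.1| ≤ n ∧ |s.2| ≤ m})
    (hp : Stable p) (hpm : p ∈ box (n + 1) (m + 1))
    (h : ∀ s : ℤ × ℤ, |s.1| ≤ n → |s.2| ≤ m → mom (fun z w => (ev z w F)⁻¹) s = mom (dens p) s)
    {z w : ℂ} (hz : ‖z‖ = 1) (hw : ‖w‖ = 1) : ev z w F = ((‖ev z w p‖ ^ 2 : ℝ) : ℂ) := by
  have hρ := contT_inv_ev hF
  have hd := hp.contT_dens
  have cF := contT_ev F
  have cg := (contT_ev p).mul (contT_ev p).conj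
  have h1 : tint (fun z w => ev z w F * (ev z w F)⁻¹) = tint fun z w => ev z w F * dens p z w := by
    have e : ∀ {ρ : ℂ → ℂ → ℂ}, ContT ρ → tint (fun z w => ev z w F * ρ z w) =
        F.sum fun s a => a * mom ρ s := fun {ρ} hρ => by
      have := pair_mom hρ F (Finsupp.single 0 1)
      simp only [ev_single, Prod.fst_zero, Prod.snd_zero, zpow_zero, mul_one, map_one] at this
      rw [← this]
      refine Finset.sum_congr rfl fun s _ => ?_
      dsimp only
      rw [Finsupp.sum_single_index (by simp)]
      simp
    rw [e hρ, e hd]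
    refine Finset.sum_congr rfl fun s hs => ?_
    have := hFm hs
    dsimp only
    rw [h s this.1 this.2]
  have h2 : tint (fun z w => ev z w p * conj (ev z w p) * (ev z w F)⁻¹) =
      tint fun z w => ev z w p * conj (ev z w p) * dens p z w := by
    rw [← pair_mom hρ, ← pair_mom hd]
    refine pair_congr hpm hpm fun s hs t ht => ?_
    rw [mem_boxSet] at hs ht
    apply h
    · rw [abs_le]; simp only [Prod.fst_sub]; omega
    · rw [abs_le]; simp only [Prod.snd_sub]; omega
  -- On the torus the integrand equals `(F - |p|²)² / (F |p|²)`, which is nonnegative.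
  have h3 : tint (fun z w => (ev z w F * dens p z w - ev z w F * (ev z w F)⁻¹) +
      (ev z w p * conj (ev z w p) * (ev z w F)⁻¹ -
        ev z w p * conj (ev z w p) * dens p z w)) = 0 := by
    rw [tint_add ((cF.mul hd).sub (cF.mul hρ)) ((cg.mul hρ).sub (cg.mul hd)),
      tint_sub (cF.mul hd) (cF.mul hρ), tint_sub (cg.mul hρ) (cg.mul hd), h1, h2]
    ring
  have hre : ∀ z w, ‖z‖ = 1 → ‖w‖ = 1 → ev z w F = ((ev z w F).re : ℂ) := fun z w hz hw => by
    apply Complex.ext <;> simp [(hF z w hz hw).1]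
  have key := eq_zero_of_tint_eq_zero
    (((cF.mul hd).sub (cF.mul hρ)).add ((cg.mul hρ).sub (cg.mul hd)))
    (r := fun z w => ((ev z w F).re - ‖ev z w p‖ ^ 2) ^ 2 / ((ev z w F).re * ‖ev z w p‖ ^ 2))
    (fun z w hz hw => by
      have h4 := (hF z w hz hw).2
      have h5 := norm_pos_iff.2 (hp z w hz.le hw.le)
      refine ⟨?_, by positivity⟩
      have h6 := hre z w hz hw
      generalize (ev z w F).re = x at *
      rw [h6, dens, Complex.mul_conj']
      have h4' : (x : ℂ) ≠ 0 := by exact_mod_cast h4.ne'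
      have h5' : (‖ev z w p‖ : ℂ) ≠ 0 := by exact_mod_cast h5.ne'
      push_cast
      field_simp
      ring) (by rw [h3]; simp) hz hw
  have h4 := (hF z w hz hw).2
  have h5 := norm_pos_iff.2 (hp z w hz.le hw.le)
  rw [div_eq_zero_iff, or_iff_left (by positivity), sq_eq_zero_iff, sub_eq_zero] at key
  rw [hre z w hz hw, key]

end Density

/-! ### The Gram–Schmidt procedure. -/

section GramSchmidt

variable {ι : Type*} [LinearOrder ι] [WellFoundedLT ι]

lemma gramSchmidt_eq {V : Type*} [AddCommGroup V] [Module ℂ V] (B : V → V → ℂ) (e : ι → V)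
    (S : Finset ι) (k : ι) {r : V}
    (hr : r = e k - ∑ i ∈ S.filter (· < k), B (e k) (gramSchmidt B e S i) • gramSchmidt B e S i) :
    gramSchmidt B e S k = ((Real.sqrt (B r r).re : ℂ))⁻¹ • r := by
  rw [gramSchmidt]
  rw [Finset.sum_attach (S.filter (· < k))
    fun i => B (e k) (gramSchmidt B e S i) • gramSchmidt B e S i, ← hr]

/-- The recursion uses only linear operations and the form, so it commutes with linear maps
preserving the form. This moves it from polynomials to `Trig` and interchanges the variables. -/
lemma map_gramSchmidt {V W : Type*} [AddCommGroup V] [Module ℂ V] [AddCommGroup W] [Module ℂ W]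
    {B : V → V → ℂ} {B' : W → W → ℂ} (τ : V →ₗ[ℂ] W) (h : ∀ x y, B x y = B' (τ x) (τ y))
    (e : ι → V) (S : Finset ι) (k : ι) :
    τ (gramSchmidt B e S k) = gramSchmidt B' (fun i => τ (e i)) S k := by
  induction k using WellFoundedLT.induction with
  | ind k ih =>
    rw [gramSchmidt_eq B e S k rfl, gramSchmidt_eq B' _ S k rfl, map_smul, h]
    have : τ (e k - ∑ i ∈ S.filter (· < k), B (e k) (gramSchmidt B e S i) • gramSchmidt B e S i) =
        τ (e k) - ∑ i ∈ S.filter (· < k), B' (τ (e k)) (gramSchmidt B' (fun i => τ (e i)) S i) •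
          gramSchmidt B' (fun i => τ (e i)) S i := by
      rw [map_sub, map_sum]
      congr 1
      refine Finset.sum_congr rfl fun i hi => ?_
      rw [map_smul, h, ih i (Finset.mem_filter.1 hi).2]
    rw [this]

variable {c : ℤ × ℤ → ℂ} {e : ι → Trig} {S : Finset ι}

lemma IsPosDef.gramSchmidt_spec (hc : IsPosDef c) (he : LinearIndependent ℂ e) (k : ι)
    (hk : k ∈ S) :
    pair c (gramSchmidt (pair c) e S k) (gramSchmidt (pair c) e S k) = 1 ∧
    (∀ i ∈ S, i < k → pair c (gramSchmidt (pair c) e S k) (gramSchmidt (pair c) e S i) = 0) ∧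
    gramSchmidt (pair c) e S k ∈ Submodule.span ℂ (e '' {i | i ∈ S ∧ i ≤ k}) ∧
    e k ∈ Submodule.span ℂ (gramSchmidt (pair c) e S '' {i | i ∈ S ∧ i ≤ k}) := by
  induction k using WellFoundedLT.induction with
  | ind k ih =>
    set g := gramSchmidt (pair c) e S
    set r := e k - ∑ i ∈ S.filter (· < k), pair c (e k) (g i) • g i with hr
    have hg : g k = ((Real.sqrt (pair c r r).re : ℂ))⁻¹ • r := gramSchmidt_eq _ _ _ _ hr
    have hsum : ∑ i ∈ S.filter (· < k), pair c (e k) (g i) • g i ∈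
        Submodule.span ℂ (e '' {i | i ∈ S ∧ i < k}) := by
      refine sum_mem fun i hi => Submodule.smul_mem _ _ ?_
      rw [Finset.mem_filter] at hi
      refine Submodule.span_mono (Set.image_mono ?_) (ih i hi.2 hi.1).2.2.1
      exact fun j hj => ⟨hj.1, hj.2.trans_lt hi.2⟩
    -- Linear independence keeps `e k` out of the span of its predecessors, so the normalization
    -- does not divide by zero.
    have hr0 : r ≠ 0 := fun h => by
      rw [hr, sub_eq_zero] at h
      rw [← h] at hsum
      exact he.notMem_span_image (s := {i | i ∈ S ∧ i < k}) (fun h => lt_irrefl _ h.2) hsum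
    have hpos := hc.pos r hr0
    set N := Real.sqrt (pair c r r).re with hN
    have hN0 : (N : ℂ) ≠ 0 := by exact_mod_cast (Real.sqrt_pos.2 hpos).ne'
    have hNN : pair c r r = N * N := by
      rw [hc.pair_self, ← Complex.ofReal_mul, hN, Real.mul_self_sqrt hpos.le]
    have hrk : r = (N : ℂ) • g k := by rw [hg, smul_smul, mul_inv_cancel₀ hN0, one_smul]
    refine ⟨?_, ?_, ?_, ?_⟩
    · rw [hg, pair_smul_left, pair_smul_right, hNN, map_inv₀, Complex.conj_ofReal]
      field_simp
    · intro j hj hjk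
      have hjm : j ∈ S.filter (· < k) := Finset.mem_filter.2 ⟨hj, hjk⟩
      rw [hg, pair_smul_left, hr, pair_sub_left, pair_sum_left, Finset.sum_eq_single j, pair_smul_left,
        (ih j hjk hj).1, mul_one, sub_self, mul_zero]
      · intro i hi hij
        rw [Finset.mem_filter] at hi
        rw [pair_smul_left]
        rcases lt_or_gt_of_ne hij with h | h
        · rw [hc.pair_comm_zero ((ih j hjk hj).2.1 i hi.1 h), mul_zero]
        · rw [(ih i hi.2 hi.1).2.1 j hj h, mul_zero]
      · exact fun h => absurd hjm h
    · rw [hg]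
      refine Submodule.smul_mem _ _ (sub_mem (Submodule.subset_span (Set.mem_image_of_mem e ?_))
        (Submodule.span_mono (Set.image_mono ?_) hsum))
      · exact ⟨hk, le_rfl⟩
      · exact fun j hj => ⟨hj.1, hj.2.le⟩
    · rw [sub_eq_iff_eq_add.1 hr.symm, hrk]
      refine add_mem (Submodule.smul_mem _ _ (Submodule.subset_span ⟨k, ⟨hk, le_rfl⟩, rfl⟩))
        (sum_mem fun i hi => Submodule.smul_mem _ _ (Submodule.subset_span ⟨i, ?_, rfl⟩))
      rw [Finset.mem_filter] at hi
      exact ⟨hi.1, hi.2.le⟩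

lemma IsPosDef.gramSchmidt_orth (hc : IsPosDef c) (he : LinearIndependent ℂ e) {i k : ι}
    (hk : k ∈ S) (hi : i ∈ S) (hik : i < k) : pair c (gramSchmidt (pair c) e S k) (e i) = 0 := by
  have h := (hc.gramSchmidt_spec he i hi).2.2.2
  generalize e i = y at h
  induction h using Submodule.span_induction with
  | mem x hx =>
    obtain ⟨j, hj, rfl⟩ := hx
    exact (hc.gramSchmidt_spec he k hk).2.1 j hj.1 (hj.2.trans_lt hik)
  | zero => simp
  | add x y _ _ hx hy => rw [pair_add_right, hx, hy, add_zero]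
  | smul a x _ hx => rw [pair_smul_right, hx, mul_zero]

end GramSchmidt

end Bicircle

/-! ### Lexicographical orthonormal polynomials and the splitting condition. -/

namespace Bicircle

open Finset MeasureTheory
open scoped ComplexConjugate

section Lex

variable {c : ℤ × ℤ → ℂ}

/-- The monomial with exponent `x`, in lexicographical order. -/
noncomputable def lexMon (x : ℕ ×ₗ ℕ) : Trig :=
  Finsupp.single (((ofLex x).1 : ℤ), ((ofLex x).2 : ℤ)) 1

/-- The exponents of degrees `≤ N` and `≤ M`, in lexicographical order. -/
def lexIdx (N M : ℕ) : Finset (ℕ ×ₗ ℕ) :=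
  (Finset.range (N + 1) ×ˢ Finset.range (M + 1)).map toLex.toEmbedding

lemma mem_lexIdx {N M : ℕ} {x : ℕ ×ₗ ℕ} :
    x ∈ lexIdx N M ↔ (ofLex x).1 ≤ N ∧ (ofLex x).2 ≤ M := by
  simp [lexIdx, Finset.mem_map_equiv]

lemma linearIndependent_lexMon : LinearIndependent ℂ lexMon := by
  have h := (Finsupp.basisSingleOne (R := ℂ) (ι := ℤ × ℤ)).linearIndependent.comp
    (fun x : ℕ ×ₗ ℕ => (((ofLex x).1 : ℤ), ((ofLex x).2 : ℤ))) (fun x y hxy => by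
      simp only [Prod.mk.injEq, Nat.cast_inj] at hxy
      exact ofLex.injective (Prod.ext hxy.1 hxy.2))
  convert h using 1
  funext x
  simp [lexMon]

/-- The orthonormal polynomials of the lexicographical order. -/
noncomputable def lexOrtho (c : ℤ × ℤ → ℂ) (N M l : ℕ) : Trig :=
  gramSchmidt (pair c) lexMon (lexIdx N M) (toLex (N, l))

lemma lexOrtho_mem (hc : IsPosDef c) {N M l : ℕ} (hl : l ≤ M) :
    lexOrtho c N M l ∈ box (N + 1) (M + 1) := by
  refine (Submodule.span_le.2 ?_) (hc.gramSchmidt_spec linearIndependent_lexMon (toLex (N, l))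
    (S := lexIdx N M) (mem_lexIdx.2 ⟨le_rfl, hl⟩)).2.2.1
  rintro _ ⟨i, hi, rfl⟩
  have := mem_lexIdx.1 hi.1
  exact single_mem_box (by rw [mem_boxSet]; dsimp only; omega) _

lemma lexOrtho_orth (hc : IsPosDef c) {N M l : ℕ} (hl : l ≤ M) {x : Trig}
    (hx : x ∈ box N (M + 1)) : pair c (lexOrtho c N M l) x = 0 := by
  refine box_induction (P := fun x => pair c (lexOrtho c N M l) x = 0) (by simp)
    (fun x y hx hy => by rw [pair_add_right, hx, hy, add_zero]) ?_ hx
  rintro ⟨i, j⟩ hs a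
  rw [mem_boxSet] at hs
  dsimp only at hs
  obtain ⟨i, rfl⟩ := Int.eq_ofNat_of_zero_le hs.1.1
  obtain ⟨j, rfl⟩ := Int.eq_ofNat_of_zero_le hs.2.1
  have e : Finsupp.single ((i : ℤ), (j : ℤ)) a = a • lexMon (toLex (i, j)) := by simp [lexMon]
  rw [e, pair_smul_right, lexOrtho, hc.gramSchmidt_orth linearIndependent_lexMon
    (S := lexIdx N M) (k := toLex (N, l)) (i := toLex (i, j))
    (mem_lexIdx.2 ⟨le_rfl, hl⟩) (mem_lexIdx.2 ⟨?_, ?_⟩), mul_zero]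
  · rw [Prod.Lex.toLex_lt_toLex]
    left
    dsimp only
    omega
  · change i ≤ N
    omega
  · change j ≤ M
    omega

lemma orthoFam_lexOrtho (hc : IsPosDef c) (N M : ℕ) :
    OrthoFam c fun l : Fin (M + 1) => lexOrtho c N M l := by
  have hmem : ∀ l : Fin (M + 1), toLex (N, (l : ℕ)) ∈ lexIdx N M := fun l =>
    mem_lexIdx.2 ⟨le_rfl, Nat.lt_succ_iff.1 l.2⟩
  have hlt : ∀ i j : Fin (M + 1), i < j → toLex (N, (i : ℕ)) < toLex (N, (j : ℕ)) := fun i j h => by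
    rw [Prod.Lex.toLex_lt_toLex]
    exact Or.inr ⟨rfl, h⟩
  refine ⟨fun i => (hc.gramSchmidt_spec linearIndependent_lexMon _ (hmem i)).1, fun i j hij => ?_⟩
  rcases lt_or_gt_of_ne hij with h | h
  · exact hc.pair_comm_zero ((hc.gramSchmidt_spec linearIndependent_lexMon _ (hmem j)).2.1 _
      (hmem i) (hlt i j h))
  · exact (hc.gramSchmidt_spec linearIndependent_lexMon _ (hmem i)).2.1 _ (hmem j) (hlt j i h)

/-- The polynomials at `z^N w^l`, `l ≤ M`, complete an orthonormal basis of `box N (M + 1)` to one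
of `box (N + 1) (M + 1)`; on a vector orthogonal to the smaller box only they contribute. -/
lemma eq_sum_lexOrtho (hc : IsPosDef c) {N M : ℕ} {x : Trig} (hx : x ∈ box (N + 1) (M + 1))
    (hxo : ∀ v ∈ box N (M + 1), pair c x v = 0) :
    x = ∑ l : Fin (M + 1), pair c x (lexOrtho c N M l) • lexOrtho c N M l := by
  have hO := orthoFam_lexOrtho hc N M
  have hle : ∀ l : Fin (M + 1), (l : ℕ) ≤ M := fun l => Nat.lt_succ_iff.1 l.2
  obtain ⟨v, hv, hvU, -⟩ := hc.exists_orthoFam (W := ⊥) (U := box N (M + 1)) bot_le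
    (d := N * (M + 1)) (by rw [finrank_bot, finrank_box, zero_add])
  have hs := hc.orthoFam_sum hv hO fun i j => hc.pair_comm_zero (lexOrtho_orth hc (hle j) (hvU i))
  have h := hs.eq_sum (U := box (N + 1) (M + 1)) (by
    rintro (i | i)
    · exact box_mono (by omega) le_rfl (hvU i)
    · exact lexOrtho_mem hc (hle i)) (by
    rw [Fintype.card_sum, Fintype.card_fin, Fintype.card_fin, finrank_box]; ring) hx
  rw [Fintype.sum_sum_type] at h
  simp only [Sum.elim_inl, Sum.elim_inr] at h
  rw [Finset.sum_eq_zero (s := Finset.univ (α := Fin (N * (M + 1)))), zero_add] at h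
  · exact h
  · intro i _
    rw [hxo _ (hvU i), zero_smul]

lemma splitOrth_iff_lexOrtho (hc : IsPosDef c) (n m : ℕ) :
    SplitOrth c (n + 1) (m + 1) ↔ ∀ (i : Fin (m + 1)) (j : Fin (n + 1)),
      pair c (lexOrtho c (n + 1) m i)
        (swapT (lexOrtho (fun s => c s.swap) (m + 1) n j)) = 0 := by
  have hc' := hc.swap
  constructor
  · intro h i j
    have hi := Nat.lt_succ_iff.1 i.2
    have hj := Nat.lt_succ_iff.1 j.2
    refine h _ (lexOrtho_mem hc hi) _ (swapT_mem_box (lexOrtho_mem hc' hj))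
      (fun v hv => lexOrtho_orth hc hi hv) fun v hv => ?_
    have := lexOrtho_orth hc' hj (swapT_mem_box hv)
    rwa [pair_swapT', swapT_swapT] at this
  · intro h x hx y hy hxo hyo
    have hy' := eq_sum_lexOrtho hc' (swapT_mem_box hy) fun v hv => by
      rw [pair_swapT', swapT_swapT]
      exact hyo _ (swapT_mem_box hv)
    have hy2 := congrArg swapT hy'
    rw [swapT_swapT, map_sum] at hy2
    rw [eq_sum_lexOrtho hc hx hxo, hy2, pair_sum_left]
    refine Finset.sum_eq_zero fun i _ => ?_
    rw [pair_sum_right]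
    refine Finset.sum_eq_zero fun j _ => ?_
    rw [map_smul, pair_smul_left, pair_smul_right, h, mul_zero, mul_zero]

end Lex

/-! ### Translation between polynomials, the matrix and Laurent coefficients. -/

section Conversion

/-- Polynomials as Laurent polynomials. -/
noncomputable def toTrig : MvPolynomial (Fin 2) ℂ →ₗ[ℂ] Trig :=
  (MvPolynomial.basisMonomials (Fin 2) ℂ).constr ℂ
    fun d => Finsupp.single ((d 0 : ℤ), (d 1 : ℤ)) 1

lemma toTrig_monomial (d : Fin 2 →₀ ℕ) (a : ℂ) :
    toTrig (MvPolynomial.monomial d a) = Finsupp.single ((d 0 : ℤ), (d 1 : ℤ)) a := by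
  have h := (MvPolynomial.basisMonomials (Fin 2) ℂ).constr_basis ℂ
    (fun d => (Finsupp.single ((d 0 : ℤ), (d 1 : ℤ)) 1 : Trig)) d
  rw [MvPolynomial.coe_basisMonomials] at h
  have e : MvPolynomial.monomial d a = a • MvPolynomial.monomial d (1 : ℂ) := by
    simp [MvPolynomial.smul_monomial]
  rw [e, map_smul, toTrig, h]
  simp

lemma X_pow_mul_X_pow (i j : ℕ) : (MvPolynomial.X 0 ^ i * MvPolynomial.X 1 ^ j :
    MvPolynomial (Fin 2) ℂ) =
      MvPolynomial.monomial (Finsupp.single 0 i + Finsupp.single 1 j) 1 := by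
  rw [MvPolynomial.X_pow_eq_monomial, MvPolynomial.X_pow_eq_monomial, MvPolynomial.monomial_mul,
    one_mul]

lemma toTrig_X_pow (i j : ℕ) : toTrig (MvPolynomial.X 0 ^ i * MvPolynomial.X 1 ^ j) =
    Finsupp.single ((i : ℤ), (j : ℤ)) 1 := by
  rw [X_pow_mul_X_pow, toTrig_monomial]
  simp

lemma ev_toTrig (P : MvPolynomial (Fin 2) ℂ) (z w : ℂ) : ev z w (toTrig P) = val P z w := by
  induction P using MvPolynomial.induction_on' with
  | monomial d a =>
    rw [toTrig_monomial, ev_single, val, MvPolynomial.eval_monomial, Finsupp.prod_fintype _ _ (by simp)]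
    simp
  | add p q hp hq => rw [map_add, map_add, hp, hq, val, val, val, map_add]

lemma toTrig_mem_box {n m : ℕ} {P : MvPolynomial (Fin 2) ℂ} (h0 : P.degreeOf 0 ≤ n)
    (h1 : P.degreeOf 1 ≤ m) : toTrig P ∈ box (n + 1) (m + 1) := by
  rw [P.as_sum, map_sum]
  refine sum_mem fun d hd => ?_
  rw [toTrig_monomial]
  have e0 := (MvPolynomial.degreeOf_le_iff.1 h0) d hd
  have e1 := (MvPolynomial.degreeOf_le_iff.1 h1) d hd
  exact single_mem_box (by rw [mem_boxSet]; dsimp only; omega) _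

lemma exists_toTrig_eq {n m : ℕ} {x : Trig} (hx : x ∈ box (n + 1) (m + 1)) :
    ∃ P : MvPolynomial (Fin 2) ℂ, P.degreeOf 0 ≤ n ∧ P.degreeOf 1 ≤ m ∧ toTrig P = x := by
  refine box_induction (P := fun x => ∃ P : MvPolynomial (Fin 2) ℂ, P.degreeOf 0 ≤ n ∧
    P.degreeOf 1 ≤ m ∧ toTrig P = x) ⟨0, by simp⟩ ?_ ?_ hx
  · rintro _ _ ⟨P, h0, h1, rfl⟩ ⟨Q, k0, k1, rfl⟩
    exact ⟨P + Q, (MvPolynomial.degreeOf_add_le _ _ _).trans (max_le h0 k0),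
      (MvPolynomial.degreeOf_add_le _ _ _).trans (max_le h1 k1), map_add _ _ _⟩
  · rintro ⟨i, j⟩ hs a
    rw [mem_boxSet] at hs
    dsimp only at hs
    obtain ⟨i, rfl⟩ := Int.eq_ofNat_of_zero_le hs.1.1
    obtain ⟨j, rfl⟩ := Int.eq_ofNat_of_zero_le hs.2.1
    refine ⟨MvPolynomial.monomial (Finsupp.single 0 i + Finsupp.single 1 j) a, ?_, ?_, ?_⟩
    · refine MvPolynomial.degreeOf_le_iff.2 fun d hd => ?_
      rw [Finset.mem_singleton.1 (MvPolynomial.support_monomial_subset hd)]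
      simp; omega
    · refine MvPolynomial.degreeOf_le_iff.2 fun d hd => ?_
      rw [Finset.mem_singleton.1 (MvPolynomial.support_monomial_subset hd)]
      simp; omega
    · rw [toTrig_monomial]; simp

variable {f : ℂ → ℂ → ℂ}

lemma form_functional (hf : ContT fun z w => (f z w)⁻¹) (P Q : MvPolynomial (Fin 2) ℂ) :
    form (functional f) P Q = pair (mom fun z w => (f z w)⁻¹) (toTrig P) (toTrig Q) := by
  rw [pair_mom hf, form, functional_eq_tint]
  · simp only [ev_toTrig, div_eq_mul_inv]
  · simp only [← ev_toTrig, div_eq_mul_inv]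
    exact ((contT_ev _).mul (contT_ev _).conj).mul hf

lemma toTrig_lexPoly (hf : ContT fun z w => (f z w)⁻¹) (N M l : ℕ) :
    toTrig (lexPoly (functional f) N M l) = lexOrtho (mom fun z w => (f z w)⁻¹) N M l := by
  rw [lexPoly, map_gramSchmidt toTrig (form_functional hf)]
  simp only [toTrig_X_pow]
  rfl

lemma toTrig_revlexPoly (hf : ContT fun z w => (f z w)⁻¹) (N M l : ℕ) :
    toTrig (revlexPoly (functional f) N M l) =
      swapT (lexOrtho (fun s => mom (fun z w => (f z w)⁻¹) s.swap) M N l) := by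
  rw [revlexPoly, map_gramSchmidt toTrig (form_functional hf), lexOrtho,
    map_gramSchmidt swapT (fun x y => pair_swapT' _ x y)]
  simp only [toTrig_X_pow, lexMon, swapT_single, Prod.swap_prod_mk]
  rfl

/-- For `n = 0` or `m = 0` the matrix is empty and one of the boxes in `SplitOrth` is zero, so both
sides hold. -/
lemma KMatrix_eq_zero_iff (hf : ContT fun z w => (f z w)⁻¹)
    (hc : IsPosDef (mom fun z w => (f z w)⁻¹)) (n m : ℕ) :
    KMatrix (functional f) n m = 0 ↔ SplitOrth (mom fun z w => (f z w)⁻¹) n m := by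
  rcases n with _ | n
  · refine iff_of_true (by ext i j; exact j.elim0) fun x _ y hy _ _ => ?_
    have : y = 0 := by
      ext s
      exact mem_box.1 hy s (by rw [mem_boxSet]; push_cast; omega)
    rw [this, pair_zero_right]
  rcases m with _ | m
  · refine iff_of_true (by ext i j; exact i.elim0) fun x hx y _ _ _ => ?_
    have : x = 0 := by
      ext s
      exact mem_box.1 hx s (by rw [mem_boxSet]; push_cast; omega)
    rw [this, pair_zero_left]
  rw [splitOrth_iff_lexOrtho hc, ← Matrix.ext_iff]
  -- The matrix lists the polynomials by decreasing index, hence `Fin.rev`.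
  have e : ∀ i j, KMatrix (functional f) (n + 1) (m + 1) i j =
      pair (mom fun z w => (f z w)⁻¹) (lexOrtho (mom fun z w => (f z w)⁻¹) (n + 1) m (Fin.rev i))
        (swapT (lexOrtho (fun s => mom (fun z w => (f z w)⁻¹) s.swap) (m + 1) n (Fin.rev j))) := by
    intro i j
    rw [KMatrix, Matrix.of_apply, form_functional hf, toTrig_lexPoly hf, toTrig_revlexPoly hf]
    simp [Fin.val_rev]
  simp only [e, Matrix.zero_apply]
  refine ⟨fun h i j => ?_, fun h i j => h _ _⟩
  simpa using h (Fin.rev i) (Fin.rev j)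

/-- The Laurent polynomial with coefficients `c`. -/
noncomputable def laurentTrig (n m : ℕ) (c : ℤ → ℤ → ℂ) : Trig :=
  ∑ k ∈ Finset.Icc (-(n : ℤ)) n, ∑ l ∈ Finset.Icc (-(m : ℤ)) m, Finsupp.single (k, l) (c k l)

lemma ev_laurentTrig (n m : ℕ) (c : ℤ → ℤ → ℂ) (z w : ℂ) :
    ev z w (laurentTrig n m c) = laurent n m c z w := by
  simp only [laurentTrig, laurent, map_sum, ev_single, mul_assoc]

lemma laurentTrig_mem (n m : ℕ) (c : ℤ → ℤ → ℂ) : laurentTrig n m c ∈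
    Finsupp.supported ℂ ℂ {s : ℤ × ℤ | |s.1| ≤ n ∧ |s.2| ≤ m} :=
  sum_mem fun _ hk => sum_mem fun _ hl => Finsupp.single_mem_supported ℂ _
    ⟨abs_le.2 (Finset.mem_Icc.1 hk), abs_le.2 (Finset.mem_Icc.1 hl)⟩

end Conversion

end Bicircle

/-! ### The two-variable Fejér–Riesz theorem. -/

theorem mainTheorem2 (n m : ℕ) (c : ℤ → ℤ → ℂ)
    (hpos : ∀ z w : ℂ, ‖z‖ = 1 → ‖w‖ = 1 →
      (Bicircle.laurent n m c z w).im = 0 ∧ 0 < (Bicircle.laurent n m c z w).re) :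
    (∃ p : MvPolynomial (Fin 2) ℂ,
      p.degreeOf 0 ≤ n ∧ p.degreeOf 1 ≤ m ∧
      (∀ z w : ℂ, ‖z‖ ≤ 1 → ‖w‖ ≤ 1 → Bicircle.val p z w ≠ 0) ∧
      (∀ z w : ℂ, ‖z‖ = 1 → ‖w‖ = 1 →
        Bicircle.laurent n m c z w = ((‖Bicircle.val p z w‖ ^ 2 : ℝ) : ℂ))) ↔
    Bicircle.KMatrix (Bicircle.functional (Bicircle.laurent n m c)) n m = 0 := by
  have hF := hpos
  simp only [← Bicircle.ev_laurentTrig] at hF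
  have hcont := Bicircle.contT_inv_ev hF
  have hc := Bicircle.isPosDef_mom_inv_ev hF
  have hmem := Bicircle.laurentTrig_mem n m c
  have hev := Bicircle.ev_laurentTrig n m c
  generalize Bicircle.laurentTrig n m c = F at *
  have hfun : Bicircle.laurent n m c = fun z w => Bicircle.ev z w F := by
    funext z w
    exact (hev z w).symm
  rw [hfun, Bicircle.KMatrix_eq_zero_iff hcont hc]
  constructor
  · rintro ⟨p, h0, h1, hst, hp⟩
    have hst' : Bicircle.Stable (Bicircle.toTrig p) := fun z w hz hw => by
      rw [Bicircle.ev_toTrig]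
      exact hst z w hz hw
    -- Moments depend on the density only through its values on the torus, where `f = |p|²`.
    have e : (Bicircle.mom fun z w => (Bicircle.ev z w F)⁻¹) =
        Bicircle.mom (Bicircle.dens (Bicircle.toTrig p)) := by
      funext s
      refine Bicircle.tint_congr fun z w hz hw => ?_
      have h : Bicircle.ev z w F = _ := hp z w hz hw
      dsimp only
      rw [h, Bicircle.dens, Complex.mul_conj', Bicircle.ev_toTrig, Complex.ofReal_pow]
    rw [e]
    exact hst'.splitOrth (Bicircle.toTrig_mem_box h0 h1)
  · intro hK
    obtain ⟨p, hp⟩ := hc.exists_isExtremal n m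
    have hst : Bicircle.Stable p := fun z w hz hw => hc.ev_ne_zero hK hp hz hw
    obtain ⟨P, h0, h1, rfl⟩ := Bicircle.exists_toTrig_eq hp.mem
    refine ⟨P, h0, h1, fun z w hz hw => ?_, fun z w hz hw => ?_⟩
    · rw [← Bicircle.ev_toTrig]
      exact hst z w hz hw
    · rw [← Bicircle.ev_toTrig]
      exact Bicircle.ev_eq_of_moment_eq hF hmem hst hp.mem
        (fun s h1 h2 => hc.moment_eq hK hp h1 h2) hz hw
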